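/- Let $\mathbb{D}$ be the closed Euclidean unit disk and let $\partial_+S\mathbb{D}$ be its inward-pointing boundary, with fan-beam coordinates $(\beta,\alpha)\in(\mathbb{R}/2\pi\mathbb{Z})\times(-\pi/2,\pi/2)$ (the point $e^{i\beta}$ with unit vector $e^{i(\beta+\pi+\alpha)}$) and measure $d\Sigma^2=d\beta\,d\alpha$. All functions are complex-valued. Let $I_0\colon L^2(\mathbb{D})\to L^2(\partial_+S\mathbb{D},d\Sigma^2)$, $$I_0f(\beta,\alpha)=\int_0^{2\cos\alpha}f\big(e^{i\beta}+te^{i(\beta+\pi+\alpha)}\big)\,dt,$$ be the X-ray transform, with adjoint $I_0^*$. Let $L^2_+$ be the space of $u\in L^2(\partial_+S\mathbb{D},d\Sigma^2)$ with $u(\beta+\pi+2\alpha,-\alpha)=u(\beta,\alpha)$ a.e. It has the orthogonal basis $$\psi_{n,k}=\tfrac{(-1)^n}{4\pi}e^{i(n-2k)(\beta+\alpha)}\big(e^{i(n+1)\alpha}+(-1)^ne^{-i(n+1)\alpha}\big),\qquad n\ge 0,\ k\in\mathbb{Z}.$$ With $T=\partial_\beta-\partial_\alpha$, one has $-T^2\psi_{n,k}=(n+1)^2\psi_{n,k}$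 and $-(T^2+\partial_\beta^2)\psi_{n,k}=\big((n+1)^2+(n-2k)^2\big)\psi_{n,k}$. A hat denotes normalization in $L^2$. For $P\in\{-T^2,\,-(T^2+\partial_\beta^2)\}$ with eigenvalues $\lambda_{n,k}$ put $P^{r}u=\sum_{n,k}\lambda_{n,k}^{r}(u,\widehat{\psi_{n,k}})\widehat{\psi_{n,k}}$, and for $s\ge 0$ define $$H^s_{T,+}(\partial_+S\mathbb{D})=\{u\in L^2_+:\ (-T^2)^{s/2}u\in L^2_+\},\qquad H^s_{+}(\partial_+S\mathbb{D})=\{u\in L^2_+:\ (-(T^2+\partial_\beta^2))^{s/2}u\in L^2_+\},$$ with norms $\|(-T^2)^{s/2}u\|_{L^2}$ and $\|(-(T^2+\partial_\beta^2))^{s/2}u\|_{L^2}$. Let $Z_{n,k}=I_0^*\psi_{n,k}$ for $0\le k\le n$ (the Zernike polynomials) and $$\widetilde H^s(\mathbb{D})=\Big\{f\in L^2(\mathbb{D}):\ \|f\|_{\widetilde H^s}^2:=\sum_{n\ge 0}(n+1)^{2s}\sum_{k=0}^n|(f,\widehat{Z_{n,k}})|^2<\infty\Big\}.$$ **Proposition.**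 Fix $s\ge 0$. (i) $H^s_+(\partial_+S\mathbb{D})\subseteq H^s_{T,+}(\partial_+S\mathbb{D})$, and the inclusion is strict if $s>0$. (ii) The topologies of $H^s_+(\partial_+S\mathbb{D})$ and $H^s_{T,+}(\partial_+S\mathbb{D})$ are equivalent on the range of $I_0$, and even on its closure in $L^2$: an element $w$ of this closure lies in $H^s_+$ if and only if it lies in $H^s_{T,+}$, and there are constants $c,C>0$ depending only on $s$ with $c\|w\|_{H^s_{T,+}}\le\|w\|_{H^s_+}\le C\|w\|_{H^s_{T,+}}$ for all such $w$. (iii) The operator $I_0\colon\widetilde H^s(\mathbb{D})\to H^{s+1/2}_+(\partial_+S\mathbb{D})$ is well defined and bounded. -/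

import Mathlib

namespace XrayDisk
noncomputable section

open MeasureTheory Set
open scoped ENNReal Real

instance factTwoPiPos : Fact (0 < 2 * π) := ⟨Real.two_pi_pos⟩

/-- Fan-beam coordinates `(β, α)`. The inward boundary `∂₊SD` is the part with `α ∈ (-π/2, π/2)`:
`(β, α)` is the boundary point `e^{iβ}` with the unit vector `e^{i(β+π+α)}`. -/
abbrev Fan : Type := AddCircle (2 * π) × ℝ

/-- The measure `dΣ² = dβ dα` on `∂₊SD`; the circle `ℝ/2πℤ` has total mass `2π`. -/
def fanMeasure : Measure Fan :=
  (volume : Measure (AddCircle (2 * π))).prod (volume.restrict (Ioo (-(π / 2)) (π / 2)))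

/-- Lebesgue measure on the closed unit disk `D`. -/
def diskMeasure : Measure ℂ := volume.restrict (Metric.closedBall 0 1)

/-- `L²(∂₊SD, dΣ²)`. -/
abbrev L2Fan : Type := Lp ℂ 2 fanMeasure
/-- `L²(D)`. -/
abbrev L2Disk : Type := Lp ℂ 2 diskMeasure

instance : IsFiniteMeasure fanMeasure := by unfold fanMeasure; infer_instance

/-- The unit-speed line `t ↦ e^{iβ} + t e^{i(β+π+α)}`; note `fourier 1 β = e^{iβ}`. -/
def geodesic (p : Fan) (t : ℝ) : ℂ :=
  fourier 1 p.1 + t * fourier 1 (p.1 + ((π + p.2 : ℝ) : AddCircle (2 * π)))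

/-- First exit time of that line from the disk. -/
def exitTime (p : Fan) : ℝ := 2 * Real.cos p.2

/-- The X-ray transform of a function on the disk. -/
def xray (f : ℂ → ℂ) (p : Fan) : ℂ := ∫ t in (0 : ℝ)..exitTime p, f (geodesic p t)

/-- The antipodal scattering relation: it maps a line to the same line with reversed orientation. -/
def scatter (p : Fan) : Fan := (p.1 + ((π + 2 * p.2 : ℝ) : AddCircle (2 * π)), -p.2)

lemma measurable_coe_addCircle : Measurable (fun x : ℝ => (x : AddCircle (2 * π))) :=
  AddCircle.measurable_mk'

lemma measurable_scatter_fst : Measurable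
    (fun q : ℝ × AddCircle (2 * π) => q.2 + ((π + 2 * q.1 : ℝ) : AddCircle (2 * π))) := by
  refine measurable_snd.add (measurable_coe_addCircle.comp ?_)
  fun_prop

lemma measurePreserving_neg_Ioo : MeasurePreserving (fun a : ℝ => -a)
    (volume.restrict (Ioo (-(π / 2)) (π / 2))) (volume.restrict (Ioo (-(π / 2)) (π / 2))) := by
  have h := (Measure.measurePreserving_neg (volume : Measure ℝ)).restrict_preimage
    (measurableSet_Ioo (a := -(π / 2)) (b := π / 2))
  simpa using h

lemma measurePreserving_scatter : MeasurePreserving scatter fanMeasure fanMeasure := by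
  have h := MeasurePreserving.skew_product (μa := volume.restrict (Ioo (-(π / 2)) (π / 2)))
    (μb := volume.restrict (Ioo (-(π / 2)) (π / 2))) (μc := (volume : Measure (AddCircle (2 * π))))
    (μd := (volume : Measure (AddCircle (2 * π))))
    (g := fun a b => b + ((π + 2 * a : ℝ) : AddCircle (2 * π)))
    measurePreserving_neg_Ioo measurable_scatter_fst
    (Filter.Eventually.of_forall fun a => (measurePreserving_add_right _ _).map_eq)
  exact (Measure.measurePreserving_swap.comp h).comp Measure.measurePreserving_swap


lemma lintegral_disk_slices (G : ℂ → ℝ≥0∞) (hG : Measurable G) :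
    ∫⁻ z, G z ∂diskMeasure = ∫⁻ y in Icc (-1 : ℝ) 1,
      ∫⁻ x in Icc (-√(1 - y ^ 2)) (√(1 - y ^ 2)), G (x + y * Complex.I) := by
  unfold diskMeasure
  have hB : MeasurableSet (Metric.closedBall (0 : ℂ) 1) := Metric.isClosed_closedBall.measurableSet
  rw [← lintegral_indicator hB,
    ← Complex.volume_preserving_equiv_real_prod.symm.lintegral_comp (hG.indicator hB),
    Measure.volume_eq_prod, lintegral_prod_symm', ← lintegral_indicator measurableSet_Icc]
  · refine lintegral_congr fun y => ?_
    by_cases hy : y ∈ Icc (-1 : ℝ) 1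
    · rw [indicator_of_mem hy, ← lintegral_indicator measurableSet_Icc]
      refine lintegral_congr fun x => ?_
      have e : Complex.measurableEquivRealProd.symm (x, y) = x + y * Complex.I := by
        apply Complex.ext <;> simp
      rw [e]
      have hiff : ((x : ℂ) + y * Complex.I ∈ Metric.closedBall (0 : ℂ) 1) ↔
          x ∈ Icc (-√(1 - y ^ 2)) (√(1 - y ^ 2)) := by
        rw [mem_closedBall_zero_iff, Complex.norm_add_mul_I, Real.sqrt_le_one, mem_Icc, ← abs_le]
        rw [← Real.sqrt_sq_eq_abs, Real.sqrt_le_sqrt_iff (by nlinarith [hy.1, hy.2])]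
        constructor <;> intro h <;> linarith
      by_cases hx : x ∈ Icc (-√(1 - y ^ 2)) (√(1 - y ^ 2))
      · rw [indicator_of_mem hx, indicator_of_mem (hiff.2 hx)]
      · rw [indicator_of_notMem hx, indicator_of_notMem (fun h => hx (hiff.1 h))]
    · rw [indicator_of_notMem hy]
      refine (lintegral_congr fun x => ?_).trans lintegral_zero
      rw [indicator_of_notMem]
      intro h
      rw [mem_closedBall_zero_iff] at h
      have := (Complex.abs_im_le_norm (Complex.measurableEquivRealProd.symm (x, y))).trans h
      have e : (Complex.measurableEquivRealProd.symm (x, y)).im = y := by simp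
      rw [e, abs_le] at this
      exact hy this
  · exact (hG.indicator hB).comp (MeasurableEquiv.measurable _)

lemma measurable_geodesic : Measurable (fun q : Fan × ℝ => geodesic q.1 q.2) := by
  have : Continuous (fun x : ℝ => (x : AddCircle (2 * π))) := AddCircle.continuous_mk' _
  have h : Continuous (fun q : Fan × ℝ => geodesic q.1 q.2) := by
    unfold geodesic; fun_prop
  exact h.measurable

lemma measurable_geodesic_right (p : Fan) : Measurable (fun t => geodesic p t) :=
  measurable_geodesic.comp (measurable_const.prodMk measurable_id)

lemma measurable_lineSet : MeasurableSet {q : Fan × ℝ | q.2 ∈ Ioc 0 (exitTime q.1)} := by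
  unfold exitTime
  exact (measurableSet_lt measurable_const measurable_snd).inter
    (measurableSet_le measurable_snd (by fun_prop))

lemma measurable_lineInt (F : ℂ → ℝ≥0∞) (hF : Measurable F) :
    Measurable (fun p : Fan => ∫⁻ t in Ioc 0 (exitTime p), F (geodesic p t)) := by
  simp_rw [← lintegral_indicator measurableSet_Ioc]
  have h : Measurable ({q : Fan × ℝ | q.2 ∈ Ioc 0 (exitTime q.1)}.indicator
      (fun q => F (geodesic q.1 q.2))) := (hF.comp measurable_geodesic).indicator measurable_lineSet
  exact h.lintegral_prod_right'

lemma lintegral_fan_slice (G : ℂ → ℝ≥0∞) (hG : Measurable G) :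
    ∫⁻ a in Ioo (-(π / 2)) (π / 2), ENNReal.ofReal (Real.cos a) *
      ∫⁻ t in Ioc 0 (2 * Real.cos a), G (Complex.exp (-(Complex.I * a)) - t)
    = ∫⁻ z, G z ∂diskMeasure := by
  rw [lintegral_disk_slices G hG]
  have him : (fun a : ℝ => -Real.sin a) '' Ioo (-(π / 2)) (π / 2) = Ioo (-1) 1 := by
    have h1 : Real.sin '' Ioo (-(π / 2)) (π / 2) = Ioo (-1) 1 :=
      Real.sinPartialHomeomorph.image_source_eq_target
    have h2 : (fun a : ℝ => -Real.sin a) = Neg.neg ∘ Real.sin := rfl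
    rw [h2, image_comp, h1]; simp
  rw [← restrict_Ioo_eq_restrict_Icc, ← him, lintegral_image_eq_lintegral_abs_deriv_mul
    (f := fun a : ℝ => -Real.sin a) (f' := fun a => -Real.cos a) measurableSet_Ioo
    (fun a _ => (Real.hasDerivAt_sin a).fun_neg.hasDerivWithinAt)]
  · refine setLIntegral_congr_fun measurableSet_Ioo fun a ha => ?_
    have hc : 0 < Real.cos a := Real.cos_pos_of_mem_Ioo ha
    have hs : √(1 - (-Real.sin a) ^ 2) = Real.cos a := by
      rw [neg_sq, ← Real.cos_sq', Real.sqrt_sq hc.le]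
    simp only [hs]
    rw [abs_neg, abs_of_pos hc]
    congr 1
    rw [restrict_Ioc_eq_restrict_Icc, ← lintegral_indicator measurableSet_Icc,
      ← lintegral_indicator measurableSet_Icc,
      ← lintegral_sub_left_eq_self (μ := volume) ((Icc (-Real.cos a) (Real.cos a)).indicator
        fun x => G (x + ((-Real.sin a : ℝ) : ℂ) * Complex.I)) (Real.cos a)]
    refine lintegral_congr fun t => ?_
    have hiff : Real.cos a - t ∈ Icc (-Real.cos a) (Real.cos a) ↔ t ∈ Icc 0 (2 * Real.cos a) := by
      simp only [mem_Icc]; constructor <;> rintro ⟨h1, h2⟩ <;> constructor <;> linarith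
    by_cases ht : t ∈ Icc 0 (2 * Real.cos a)
    · rw [indicator_of_mem ht, indicator_of_mem (hiff.2 ht)]
      congr 1
      have : -(Complex.I * a) = ((-a : ℝ) : ℂ) * Complex.I := by push_cast; ring
      rw [this, Complex.exp_mul_I]
      push_cast
      rw [Complex.cos_neg, Complex.sin_neg]
      ring
    · rw [indicator_of_notMem ht, indicator_of_notMem (fun h => ht (hiff.1 h))]
  · intro a ha b hb h
    exact Real.injOn_sin (Ioo_subset_Icc_self ha) (Ioo_subset_Icc_self hb) (neg_injective h)

lemma lintegral_disk_rotate (G : ℂ → ℝ≥0∞) (hG : Measurable G) (u : Circle) :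
    ∫⁻ z, G (u * z) ∂diskMeasure = ∫⁻ z, G z ∂diskMeasure := by
  have h := ((rotation u).measurePreserving).restrict_preimage
    (Metric.isClosed_closedBall.measurableSet (s := Metric.closedBall (0 : ℂ) 1))
  have e : (rotation u) ⁻¹' (Metric.closedBall (0 : ℂ) 1) = Metric.closedBall 0 1 := by
    ext z
    rw [mem_preimage, mem_closedBall_zero_iff, mem_closedBall_zero_iff, LinearIsometryEquiv.norm_map]
  rw [e] at h
  have := h.lintegral_comp hG
  simpa [diskMeasure] using this

lemma geodesic_shift (b : AddCircle (2 * π)) (a t : ℝ) :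
    geodesic (b - (a : AddCircle (2 * π)), a) t =
      (AddCircle.toCircle b : ℂ) * (Complex.exp (-(Complex.I * a)) - t) := by
  unfold geodesic
  have e1 : b - (a : AddCircle (2 * π)) + ((π + a : ℝ) : AddCircle (2 * π)) =
      b + ((π : ℝ) : AddCircle (2 * π)) := by
    rw [AddCircle.coe_add]; abel
  have e2 : b - (a : AddCircle (2 * π)) = b + ((-a : ℝ) : AddCircle (2 * π)) := by
    rw [AddCircle.coe_neg]; abel
  simp only [e1]
  rw [e2]
  have f1 : ∀ x : ℝ, fourier 1 (b + (x : AddCircle (2 * π))) =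
      (AddCircle.toCircle b : ℂ) * Complex.exp (Complex.I * x) := by
    intro x
    rw [fourier_apply, one_smul, AddCircle.toCircle_add, Circle.coe_mul,
      AddCircle.toCircle_apply_mk, Circle.coe_exp]
    congr 2
    have : (π : ℂ) ≠ 0 := by exact_mod_cast Real.pi_ne_zero
    push_cast
    field_simp
  rw [f1, f1]
  have : Complex.exp (Complex.I * π) = -1 := by rw [mul_comm]; exact Complex.exp_pi_mul_I
  rw [this]
  push_cast
  ring_nf

/-- The Santalo formula on the disk. -/
lemma lintegral_santalo (F : ℂ → ℝ≥0∞) (hF : Measurable F) :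
    ∫⁻ p, ENNReal.ofReal (Real.cos p.2) *
      (∫⁻ t in Ioc 0 (exitTime p), F (geodesic p t)) ∂fanMeasure
    = ENNReal.ofReal (2 * π) * ∫⁻ z, F z ∂diskMeasure := by
  have hm : Measurable (fun p : Fan => ENNReal.ofReal (Real.cos p.2) *
      (∫⁻ t in Ioc 0 (exitTime p), F (geodesic p t))) :=
    Measurable.mul (by fun_prop) (measurable_lineInt F hF)
  have hsh : Measurable (fun p : Fan => (p.1 - (p.2 : AddCircle (2 * π)), p.2)) :=
    (measurable_fst.sub (measurable_coe_addCircle.comp measurable_snd)).prodMk measurable_snd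
  unfold fanMeasure
  rw [lintegral_prod_symm' _ hm]
  have e1 : ∀ a : ℝ, ∫⁻ b : AddCircle (2 * π), ENNReal.ofReal (Real.cos a) *
      (∫⁻ t in Ioc 0 (exitTime (b, a)), F (geodesic (b, a) t)) =
      ∫⁻ b : AddCircle (2 * π), ENNReal.ofReal (Real.cos a) *
      (∫⁻ t in Ioc 0 (2 * Real.cos a),
        F ((AddCircle.toCircle b : ℂ) * (Complex.exp (-(Complex.I * a)) - t))) := by
    intro a
    rw [← lintegral_sub_right_eq_self _ (a : AddCircle (2 * π))]
    simp only [geodesic_shift]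
    rfl
  simp only [e1]
  have hm2 := hm.comp hsh
  simp only [Function.comp_def, geodesic_shift, exitTime] at hm2
  rw [lintegral_lintegral_swap (f := fun a b => ENNReal.ofReal (Real.cos a) *
      (∫⁻ t in Ioc 0 (2 * Real.cos a),
        F ((AddCircle.toCircle b : ℂ) * (Complex.exp (-(Complex.I * a)) - t))))
    (hm2.comp measurable_swap).aemeasurable]
  have e2 : ∀ b : AddCircle (2 * π), ∫⁻ a in Ioo (-(π / 2)) (π / 2), ENNReal.ofReal (Real.cos a) *
      (∫⁻ t in Ioc 0 (2 * Real.cos a),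
        F ((AddCircle.toCircle b : ℂ) * (Complex.exp (-(Complex.I * a)) - t))) =
      ∫⁻ z, F z ∂diskMeasure := by
    intro b
    rw [← lintegral_disk_rotate F hF (AddCircle.toCircle b)]
    exact lintegral_fan_slice (fun z => F ((AddCircle.toCircle b : ℂ) * z)) (by fun_prop)
  simp only [e2]
  rw [lintegral_const, AddCircle.measure_univ, mul_comm]

lemma ae_cos_pos : ∀ᵐ p ∂fanMeasure, 0 < Real.cos p.2 := by
  unfold fanMeasure
  have h : ∀ᵐ a ∂(volume.restrict (Ioo (-(π / 2)) (π / 2))), 0 < Real.cos a := by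
    filter_upwards [ae_restrict_mem measurableSet_Ioo] with a ha using Real.cos_pos_of_mem_Ioo ha
  exact Measure.quasiMeasurePreserving_snd.ae h

lemma ae_line_of_ae {P : ℂ → Prop} (hP : ∀ᵐ z ∂diskMeasure, P z) :
    ∀ᵐ p ∂fanMeasure, ∀ᵐ t ∂(volume.restrict (Ioc 0 (exitTime p))), P (geodesic p t) := by
  obtain ⟨N, hN, hNm, hN0⟩ := exists_measurable_superset_of_null (ae_iff.1 hP)
  have h := lintegral_santalo (N.indicator 1) (measurable_one.indicator hNm)
  rw [lintegral_indicator_one hNm, hN0, mul_zero, lintegral_eq_zero_iff] at h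
  · filter_upwards [h, ae_cos_pos] with p hp hc
    simp only [Pi.zero_apply, mul_eq_zero, ENNReal.ofReal_eq_zero, not_le.2 hc, false_or] at hp
    have hNt : Measurable (fun t => N.indicator (1 : ℂ → ℝ≥0∞) (geodesic p t)) :=
      (measurable_one.indicator hNm).comp (measurable_geodesic_right p)
    rw [lintegral_eq_zero_iff hNt] at hp
    filter_upwards [hp] with t ht
    by_contra hcon
    have : geodesic p t ∈ N := hN hcon
    simp [this] at ht
  · exact Measurable.mul (by fun_prop) (measurable_lineInt _ (measurable_one.indicator hNm))

lemma sq_lintegral_le (g : ℝ → ℝ≥0∞) (hg : Measurable g) (c : ℝ) :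
    (∫⁻ t in Ioc 0 c, g t) ^ 2 ≤ ENNReal.ofReal c * ∫⁻ t in Ioc 0 c, g t ^ 2 := by
  have h := ENNReal.lintegral_mul_le_Lp_mul_Lq (volume.restrict (Ioc 0 c))
    (Real.HolderConjugate.two_two) (f := 1) (g := g) aemeasurable_one hg.aemeasurable
  simp only [Pi.one_apply, one_mul, Pi.mul_apply, lintegral_const, one_pow,
    Measure.restrict_apply_univ, Real.volume_Ioc, sub_zero, ENNReal.rpow_two] at h
  calc _ ≤ _ := pow_le_pow_left₀ zero_le h 2
    _ = _ := by
      have e : ∀ x : ℝ≥0∞, (x ^ (1 / 2 : ℝ)) ^ 2 = x := fun x => by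
        rw [← ENNReal.rpow_natCast, ← ENNReal.rpow_mul]; norm_num
      rw [mul_pow, e, e]

lemma aestronglyMeasurable_xray {f : ℂ → ℂ} (hf : StronglyMeasurable f) :
    AEStronglyMeasurable (xray f) fanMeasure := by
  have hm : StronglyMeasurable (fun p : Fan => ∫ t, {q : Fan × ℝ | q.2 ∈ Ioc 0 (exitTime q.1)}.indicator
      (fun q => f (geodesic q.1 q.2)) (p, t)) :=
    ((hf.comp_measurable measurable_geodesic).indicator measurable_lineSet).integral_prod_right'
  refine hm.aestronglyMeasurable.congr ?_
  filter_upwards [ae_cos_pos] with p hp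
  have h0 : 0 ≤ exitTime p := by unfold exitTime; positivity
  unfold xray
  rw [intervalIntegral.integral_of_le h0, ← integral_indicator measurableSet_Ioc]
  rfl

lemma lintegral_xray_sq_le {f : ℂ → ℂ} (hf : StronglyMeasurable f) :
    ∫⁻ p, ‖xray f p‖ₑ ^ 2 ∂fanMeasure ≤ ENNReal.ofReal (4 * π) * ∫⁻ z, ‖f z‖ₑ ^ 2 ∂diskMeasure := by
  have hm : Measurable (fun z => ‖f z‖ₑ) := hf.enorm
  have hs := lintegral_santalo (fun z => ‖f z‖ₑ ^ 2) (hm.pow_const 2)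
  have h2 : ENNReal.ofReal (4 * π) = 2 * ENNReal.ofReal (2 * π) := by
    rw [← ENNReal.ofReal_ofNat 2, ← ENNReal.ofReal_mul (by norm_num)]; congr 1; ring
  rw [h2, mul_assoc, ← hs, ← lintegral_const_mul]
  · refine lintegral_mono_ae ?_
    filter_upwards [ae_cos_pos] with p hp
    have h0 : 0 ≤ exitTime p := by unfold exitTime; positivity
    have hle : ‖xray f p‖ₑ ≤ ∫⁻ t in Ioc 0 (exitTime p), ‖f (geodesic p t)‖ₑ := by
      unfold xray
      rw [intervalIntegral.integral_of_le h0]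
      exact enorm_integral_le_lintegral_enorm _
    refine (pow_le_pow_left₀ zero_le hle 2).trans ?_
    refine (sq_lintegral_le (fun t => ‖f (geodesic p t)‖ₑ)
      (hm.comp (measurable_geodesic_right p)) _).trans ?_
    rw [← mul_assoc]
    gcongr
    rw [← ENNReal.ofReal_ofNat 2, ← ENNReal.ofReal_mul (by norm_num)]
    rfl
  · exact Measurable.mul (by fun_prop) (measurable_lineInt _ (hm.pow_const 2))

lemma xray_congr {f g : ℂ → ℂ} (h : f =ᵐ[diskMeasure] g) : xray f =ᵐ[fanMeasure] xray g := by
  filter_upwards [ae_line_of_ae h, ae_cos_pos] with p hp hc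
  have h0 : 0 ≤ exitTime p := by unfold exitTime; positivity
  unfold xray
  rw [intervalIntegral.integral_of_le h0, intervalIntegral.integral_of_le h0]
  exact integral_congr_ae hp

lemma lintegral_enorm_sq_eq {α : Type*} [MeasurableSpace α] (μ : Measure α) (f : α → ℂ) :
    ∫⁻ x, ‖f x‖ₑ ^ 2 ∂μ = eLpNorm f 2 μ ^ 2 := by
  rw [eLpNorm_eq_lintegral_rpow_enorm_toReal (by norm_num) (by norm_num)]
  simp only [ENNReal.toReal_ofNat, ENNReal.rpow_two]
  rw [← ENNReal.rpow_natCast, ← ENNReal.rpow_mul]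
  norm_num

lemma eLpNorm_xray_le {f : ℂ → ℂ} (hf : StronglyMeasurable f) :
    eLpNorm (xray f) 2 fanMeasure ≤ ENNReal.ofReal (√(4 * π)) * eLpNorm f 2 diskMeasure := by
  have h := lintegral_xray_sq_le hf
  rw [lintegral_enorm_sq_eq, lintegral_enorm_sq_eq] at h
  have e : ENNReal.ofReal (4 * π) = ENNReal.ofReal (√(4 * π)) ^ 2 := by
    rw [← ENNReal.ofReal_pow (Real.sqrt_nonneg _), Real.sq_sqrt (by positivity)]
  rw [e, ← mul_pow] at h
  exact (ENNReal.pow_le_pow_left_iff (by norm_num)).1 h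

lemma memLp_xray (f : L2Disk) : MemLp (xray f) 2 fanMeasure :=
  ⟨aestronglyMeasurable_xray (Lp.stronglyMeasurable f),
    (eLpNorm_xray_le (Lp.stronglyMeasurable f)).trans_lt
      (ENNReal.mul_lt_top ENNReal.ofReal_lt_top (Lp.eLpNorm_lt_top f))⟩

/-- An `L²` function is integrable along almost every line, so the integrals defining `xray` are
genuine. -/
lemma ae_integrable_line (f : L2Disk) : ∀ᵐ p ∂fanMeasure,
    IntegrableOn (fun t => f (geodesic p t)) (Ioc 0 (exitTime p)) := by
  have hm : Measurable (fun z => ‖f z‖ₑ) := (Lp.stronglyMeasurable f).enorm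
  have hs := lintegral_santalo (fun z => ‖f z‖ₑ ^ 2) (hm.pow_const 2)
  have hfin : ENNReal.ofReal (2 * π) * ∫⁻ z, ‖f z‖ₑ ^ 2 ∂diskMeasure ≠ ∞ := by
    rw [lintegral_enorm_sq_eq]
    exact ENNReal.mul_ne_top ENNReal.ofReal_ne_top (ENNReal.pow_ne_top (Lp.eLpNorm_ne_top f))
  rw [← hs] at hfin
  filter_upwards [ae_lt_top (Measurable.mul (by fun_prop) (measurable_lineInt _ (hm.pow_const 2)))
    hfin, ae_cos_pos] with p hp hc
  refine ⟨((Lp.stronglyMeasurable f).comp_measurable (measurable_geodesic_right p)).aestronglyMeasurable, ?_⟩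
  have hI : ∫⁻ t in Ioc 0 (exitTime p), ‖f (geodesic p t)‖ₑ ^ 2 < ∞ := by
    by_contra hcon
    rw [not_lt, top_le_iff] at hcon
    simp only [Pi.mul_apply] at hp
    rw [hcon, ENNReal.mul_top (by simpa using hc)] at hp
    exact lt_irrefl _ hp
  have := (sq_lintegral_le (fun t => ‖f (geodesic p t)‖ₑ) (hm.comp (measurable_geodesic_right p))
      (exitTime p)).trans_lt (ENNReal.mul_lt_top ENNReal.ofReal_lt_top hI)
  exact (ENNReal.pow_lt_top_iff.1 this).resolve_right (by norm_num)

/-- The X-ray transform as a bounded operator from `L²(D)` to `L²(∂₊SD, dΣ²)`. -/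
def I0 : L2Disk →L[ℂ] L2Fan :=
  LinearMap.mkContinuous
    { toFun := fun f => (memLp_xray f).toLp (xray f)
      map_add' := by
        intro f g
        apply Lp.ext
        filter_upwards [(memLp_xray (f + g)).coeFn_toLp, (memLp_xray f).coeFn_toLp,
          (memLp_xray g).coeFn_toLp, Lp.coeFn_add ((memLp_xray f).toLp (xray f))
          ((memLp_xray g).toLp (xray g)), xray_congr (Lp.coeFn_add f g),
          ae_integrable_line f, ae_integrable_line g, ae_cos_pos] with p h1 h2 h3 h4 h5 hf hg hc
        have h0 : 0 ≤ exitTime p := by unfold exitTime; positivity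
        rw [h1, h4, Pi.add_apply, h2, h3, h5]
        unfold xray
        simp only [intervalIntegral.integral_of_le h0, Pi.add_apply]
        exact integral_add hf hg
      map_smul' := by
        intro c f
        apply Lp.ext
        filter_upwards [(memLp_xray (c • f)).coeFn_toLp, (memLp_xray f).coeFn_toLp,
          Lp.coeFn_smul c ((memLp_xray f).toLp (xray f)), xray_congr (Lp.coeFn_smul c f)]
          with p h1 h2 h3 h4
        simp only [RingHom.id_apply]
        rw [h1, h3, Pi.smul_apply, h2, h4]
        unfold xray
        exact intervalIntegral.integral_smul c _ }
    (√(4 * π))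
    (by
      intro f
      simp only [LinearMap.coe_mk, AddHom.coe_mk, Lp.norm_toLp]
      rw [Lp.norm_def, ← ENNReal.toReal_ofReal (Real.sqrt_nonneg (4 * π)), ← ENNReal.toReal_mul]
      exact ENNReal.toReal_mono (ENNReal.mul_ne_top ENNReal.ofReal_ne_top (Lp.eLpNorm_ne_top f))
        (eLpNorm_xray_le (Lp.stronglyMeasurable f)))

/-- `I0 f` is represented by the line integrals of `f`. -/
lemma coeFn_I0 (f : L2Disk) : I0 f =ᵐ[fanMeasure] xray f := (memLp_xray f).coeFn_toLp

/-- The subspace `L²₊` of the `u` invariant under the antipodal scattering relation. -/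
def L2plus : Submodule ℂ L2Fan :=
  LinearMap.ker (LinearMap.id - Lp.compMeasurePreservingₗ ℂ scatter measurePreserving_scatter)

/-- The vector field `T = ∂_β - ∂_α`, as derivative along its flow. -/
def opT (u : Fan → ℂ) (p : Fan) : ℂ :=
  deriv (fun t : ℝ => u (p.1 + (t : AddCircle (2 * π)), p.2 - t)) 0
/-- The vector field `∂_β`, as derivative along its flow. -/
def opBeta (u : Fan → ℂ) (p : Fan) : ℂ :=
  deriv (fun t : ℝ => u (p.1 + (t : AddCircle (2 * π)), p.2)) 0

/-- The function `ψ_{n,k}(β, α) =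
(-1)^n / (4π) e^{i(n-2k)(β+α)} (e^{i(n+1)α} + (-1)^n e^{-i(n+1)α})`; note `fourier m θ = e^{imθ}`. -/
def psi (n : ℕ) (k : ℤ) (p : Fan) : ℂ :=
  (-1) ^ n / (4 * π) * fourier (n - 2 * k) (p.1 + (p.2 : AddCircle (2 * π))) *
    (Complex.exp (Complex.I * (n + 1) * p.2) + (-1) ^ n * Complex.exp (-(Complex.I * (n + 1) * p.2)))

lemma fourier_two_pi (m : ℤ) (x : ℝ) :
    fourier m (x : AddCircle (2 * π)) = Complex.exp (Complex.I * m * x) := by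
  rw [fourier_coe_apply]
  congr 1
  have : (π : ℂ) ≠ 0 := by exact_mod_cast Real.pi_ne_zero
  push_cast
  field_simp

lemma opT_psi (n : ℕ) (k : ℤ) : opT (opT (psi n k)) = fun p => -((n : ℂ) + 1) ^ 2 * psi n k p := by
  have key : ∀ (c : ℂ), ∀ p : Fan, opT (fun p : Fan => fourier (n - 2 * k) (p.1 + (p.2 : AddCircle (2 * π))) *
      (Complex.exp (Complex.I * (n + 1) * p.2) + c * Complex.exp (-(Complex.I * (n + 1) * p.2)))) p =
      -(Complex.I * (n + 1)) * (fourier (n - 2 * k) (p.1 + (p.2 : AddCircle (2 * π))) *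
      (Complex.exp (Complex.I * (n + 1) * p.2) + (-c) * Complex.exp (-(Complex.I * (n + 1) * p.2)))) := by
    intro c p
    unfold opT
    have e : ∀ t : ℝ, p.1 + (t : AddCircle (2 * π)) + ((p.2 - t : ℝ) : AddCircle (2 * π))
        = p.1 + (p.2 : AddCircle (2 * π)) := by
      intro t
      rw [AddCircle.coe_sub]; abel
    simp only [e]
    have h1 : HasDerivAt (fun t : ℝ => Complex.I * (n + 1) * ((p.2 - t : ℝ) : ℂ))
        (-(Complex.I * (n + 1))) 0 := by
      have := (((hasDerivAt_id (0 : ℝ)).const_sub p.2).ofReal_comp).const_mul (Complex.I * ((n : ℂ) + 1))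
      simpa using this
    have h := ((h1.cexp).add ((h1.neg.cexp).const_mul c)).const_mul
      (fourier (n - 2 * k) (p.1 + (p.2 : AddCircle (2 * π))))
    refine h.deriv.trans ?_
    simp only [Pi.neg_apply, sub_zero]
    ring
  have lin : ∀ (a : ℂ) (u : Fan → ℂ), opT (fun p => a * u p) = fun p => a * opT u p := by
    intro a u; funext p; simp [opT, deriv_const_mul_field]
  have e0 : psi n k = fun p => ((-1) ^ n / (4 * π) : ℂ) *
      (fun p : Fan => fourier (n - 2 * k) (p.1 + (p.2 : AddCircle (2 * π))) *
      (Complex.exp (Complex.I * (n + 1) * p.2) + (-1) ^ n * Complex.exp (-(Complex.I * (n + 1) * p.2)))) p := by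
    funext p; simp only [psi]; ring
  rw [e0, lin, funext (key _), lin, lin, funext (key _)]
  funext p
  simp only [neg_neg]
  linear_combination ((n : ℂ) + 1) ^ 2 * ((-1) ^ n / (4 * π) : ℂ) *
      (fourier (n - 2 * k) (p.1 + (p.2 : AddCircle (2 * π))) *
      (Complex.exp (Complex.I * (n + 1) * p.2) + (-1) ^ n * Complex.exp (-(Complex.I * (n + 1) * p.2)))) * Complex.I_sq

lemma opBeta_psi (n : ℕ) (k : ℤ) :
    opBeta (psi n k) = fun p => Complex.I * ((n : ℂ) - 2 * k) * psi n k p := by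
  funext p
  have e : ∀ t : ℝ, psi n k (p.1 + (t : AddCircle (2 * π)), p.2) =
      psi n k p * Complex.exp (Complex.I * ((n : ℂ) - 2 * k) * t) := by
    intro t
    have : p.1 + (t : AddCircle (2 * π)) + (p.2 : AddCircle (2 * π)) =
        p.1 + (p.2 : AddCircle (2 * π)) + (t : AddCircle (2 * π)) := by abel
    simp only [psi]
    rw [this, fourier_apply, smul_add, AddCircle.toCircle_add, Circle.coe_mul, ← fourier_apply,
      ← fourier_apply, fourier_two_pi]
    push_cast
    ring
  unfold opBeta
  simp only [e]
  have h1 : HasDerivAt (fun t : ℝ => Complex.I * ((n : ℂ) - 2 * k) * (t : ℂ))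
        (Complex.I * ((n : ℂ) - 2 * k)) 0 := by
    have := ((hasDerivAt_id (0 : ℝ)).ofReal_comp).const_mul (Complex.I * ((n : ℂ) - 2 * k))
    simpa using this
  refine (h1.cexp.const_mul _).deriv.trans ?_
  simp; ring

lemma continuous_psi (n : ℕ) (k : ℤ) : Continuous (psi n k) := by
  have : Continuous (fun x : ℝ => (x : AddCircle (2 * π))) := AddCircle.continuous_mk' _
  unfold psi
  fun_prop

lemma memLp_psi (n : ℕ) (k : ℤ) : MemLp (psi n k) 2 fanMeasure := by
  refine MemLp.of_bound (continuous_psi n k).aestronglyMeasurable (1 / (4 * π) * 1 * (1 + 1)) ?_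
  refine Filter.Eventually.of_forall fun p => ?_
  have h : ∀ x : ℝ, ‖Complex.exp (Complex.I * (n + 1) * x)‖ = 1 := by
    intro x
    have := Complex.norm_exp_ofReal_mul_I ((n + 1) * x)
    rw [← this]; congr 2; push_cast; ring
  have h' : ‖Complex.exp (-(Complex.I * (n + 1) * p.2))‖ = 1 := by
    rw [← h (-p.2)]; congr 2; push_cast; ring
  unfold psi
  rw [norm_mul, norm_mul]
  gcongr
  · rw [norm_div, norm_pow, norm_neg, norm_one, one_pow, norm_mul]
    simp [abs_of_pos Real.pi_pos]
  · rw [fourier_apply, Circle.norm_coe]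
  · refine (norm_add_le _ _).trans ?_
    rw [norm_mul, norm_pow, norm_neg, norm_one, one_pow, h, h', one_mul]


/-- `ψ_{n,k}` as an element of `L²(∂₊SD, dΣ²)`. -/
def psiL2 (n : ℕ) (k : ℤ) : L2Fan := (memLp_psi n k).toLp (psi n k)

/-- The normalization of `ψ_{n,k}` in `L²(∂₊SD, dΣ²)`. -/
def psiHat (n : ℕ) (k : ℤ) : L2Fan := ((‖psiL2 n k‖⁻¹ : ℝ) : ℂ) • psiL2 n k

/-- An operator on functions on `∂₊SD` that acts diagonally on the `ψ_{n,k}`, with its eigenvalues. -/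
structure DiagonalOperator where
  toFun : (Fan → ℂ) → Fan → ℂ
  eigenvalue : ℕ → ℤ → ℝ
  apply_psi : ∀ n k, toFun (psi n k) = fun p => (eigenvalue n k : ℂ) * psi n k p

/-- The operator `-T²`. -/
def negTSq : DiagonalOperator where
  toFun u p := -opT (opT u) p
  eigenvalue n _ := ((n : ℝ) + 1) ^ 2
  apply_psi n k := by
    funext p
    rw [opT_psi]
    push_cast
    ring

/-- The elliptic operator `-(T² + ∂_β²)`. -/
def negEllip : DiagonalOperator where
  toFun u p := -(opT (opT u) p + opBeta (opBeta u) p)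
  eigenvalue n k := ((n : ℝ) + 1) ^ 2 + ((n : ℝ) - 2 * k) ^ 2
  apply_psi n k := by
    funext p
    have lin : ∀ (a : ℂ) (u : Fan → ℂ), opBeta (fun p => a * u p) = fun p => a * opBeta u p := by
      intro a u; funext p; simp [opBeta, deriv_const_mul_field]
    rw [opT_psi, opBeta_psi, lin, opBeta_psi]
    push_cast
    linear_combination (-((n : ℂ) - 2 * k) ^ 2 * psi n k p) * Complex.I_sq

namespace DiagonalOperator

/-- The term `λ_{n,k}^r ⟨u, ψ̂_{n,k}⟩ ψ̂_{n,k}` of the expansion of `P^r u`. -/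
def powerTerm (P : DiagonalOperator) (r : ℝ) (u : L2Fan) (nk : ℕ × ℤ) : L2Fan :=
  (((P.eigenvalue nk.1 nk.2 ^ r : ℝ) : ℂ) * inner ℂ (psiHat nk.1 nk.2) u) • psiHat nk.1 nk.2

/-- The power `P^r u = ∑ λ_{n,k}^r ⟨u, ψ̂_{n,k}⟩ ψ̂_{n,k}` given by the functional calculus of `P` in
`L²₊`; it is meaningful when the series converges in `L²`. -/
def power (P : DiagonalOperator) (r : ℝ) (u : L2Fan) : L2Fan := ∑' nk, P.powerTerm r u nk

/-- The Sobolev space `{u ∈ L²₊ : P^{s/2} u ∈ L²₊}`. -/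
def sobolev (P : DiagonalOperator) (s : ℝ) : Submodule ℂ L2Fan where
  carrier := {u | u ∈ L2plus ∧ Summable (P.powerTerm (s / 2) u) ∧ P.power (s / 2) u ∈ L2plus}
  zero_mem' := by
    have h : P.powerTerm (s / 2) 0 = fun _ => 0 := by funext nk; simp [powerTerm]
    refine ⟨L2plus.zero_mem, ?_, ?_⟩
    · rw [h]; exact summable_zero
    · rw [power, h, tsum_zero]; exact L2plus.zero_mem
  add_mem' := by
    rintro u v ⟨hu, hu1, hu2⟩ ⟨hv, hv1, hv2⟩
    have h : P.powerTerm (s / 2) (u + v) =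
        fun nk => P.powerTerm (s / 2) u nk + P.powerTerm (s / 2) v nk := by
      funext nk; simp only [powerTerm, inner_add_right, mul_add, add_smul]
    refine ⟨L2plus.add_mem hu hv, ?_, ?_⟩
    · rw [h]; exact hu1.add hv1
    · rw [power, h, hu1.tsum_add hv1]; exact L2plus.add_mem hu2 hv2
  smul_mem' := by
    rintro c u ⟨hu, hu1, hu2⟩
    have h : P.powerTerm (s / 2) (c • u) = fun nk => c • P.powerTerm (s / 2) u nk := by
      funext nk; simp only [powerTerm, inner_smul_right, smul_smul]; congr 1; ring
    refine ⟨L2plus.smul_mem c hu, ?_, ?_⟩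
    · rw [h]; exact hu1.const_smul c
    · rw [power, h, hu1.tsum_const_smul c]; exact L2plus.smul_mem c hu2

/-- The norm `‖P^{s/2} u‖` of the Sobolev space. -/
def sobolevNorm (P : DiagonalOperator) (s : ℝ) (u : L2Fan) : ℝ := ‖P.power (s / 2) u‖

end DiagonalOperator

/-- The space `H^s_{T,+}(∂₊SD)`. -/
def HT (s : ℝ) : Submodule ℂ L2Fan := negTSq.sobolev s

/-- The norm of `H^s_{T,+}(∂₊SD)`. -/
def normHT (s : ℝ) (u : L2Fan) : ℝ := negTSq.sobolevNorm s u

/-- The classical space `H^s_+(∂₊SD)`. -/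
def HPlus (s : ℝ) : Submodule ℂ L2Fan := negEllip.sobolev s

/-- The norm of `H^s_+(∂₊SD)`. -/
def normHPlus (s : ℝ) (u : L2Fan) : ℝ := negEllip.sobolevNorm s u

/-- The Zernike polynomial `Z_{n,k} = I₀^* ψ_{n,k}`, for `0 ≤ k ≤ n`; the adjoint is taken between
`L²(D)` and `L²(∂₊SD, dΣ²)`. -/
def zernike (n k : ℕ) : L2Disk := ContinuousLinearMap.adjoint I0 (psiL2 n k)

/-- The normalization of `Z_{n,k}` in `L²(D)`. -/
def zernikeHat (n k : ℕ) : L2Disk := ((‖zernike n k‖⁻¹ : ℝ) : ℂ) • zernike n k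

/-- The term `(n+1)^{2s} ∑_{k=0}^n |f_{n,k}|²`, where `f_{n,k}` are the Zernike coefficients. -/
def zernikeTerm (s : ℝ) (f : L2Disk) (n : ℕ) : ℝ :=
  ((n : ℝ) + 1) ^ (2 * s) * ∑ k ∈ Finset.range (n + 1), ‖inner ℂ (zernikeHat n k) f‖ ^ 2

lemma zernikeTerm_nonneg (s : ℝ) (f : L2Disk) (n : ℕ) : 0 ≤ zernikeTerm s f n := by
  unfold zernikeTerm; positivity

/-- The Sobolev-Zernike space of order `s`, for `s ≥ 0`. -/
def HTilde (s : ℝ) : Submodule ℂ L2Disk where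
  carrier := {f | Summable (zernikeTerm s f)}
  zero_mem' := by
    have h : zernikeTerm s 0 = fun _ => 0 := by funext n; simp [zernikeTerm]
    rw [mem_ofPred_eq, h]; exact summable_zero
  add_mem' := by
    intro f g hf hg
    refine Summable.of_nonneg_of_le (zernikeTerm_nonneg s _) (fun n => ?_)
      ((hf.add hg).mul_left 2)
    have e : 2 * (zernikeTerm s f n + zernikeTerm s g n) = ((n : ℝ) + 1) ^ (2 * s) *
        ∑ k ∈ Finset.range (n + 1),
          2 * (‖inner ℂ (zernikeHat n k) f‖ ^ 2 + ‖inner ℂ (zernikeHat n k) g‖ ^ 2) := by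
      unfold zernikeTerm
      rw [← Finset.mul_sum, Finset.sum_add_distrib]
      ring
    rw [e]
    unfold zernikeTerm
    refine mul_le_mul_of_nonneg_left (Finset.sum_le_sum fun k _ => ?_) (by positivity)
    rw [inner_add_right]
    refine (pow_le_pow_left₀ (norm_nonneg _) (norm_add_le _ _) 2).trans ?_
    nlinarith [sq_nonneg (‖inner ℂ (zernikeHat n k) f‖ - ‖inner ℂ (zernikeHat n k) g‖)]
  smul_mem' := by
    intro c f hf
    have h : zernikeTerm s (c • f) = fun n => ‖c‖ ^ 2 * zernikeTerm s f n := by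
      funext n
      simp only [zernikeTerm, inner_smul_right, norm_mul, mul_pow, ← Finset.mul_sum]
      ring
    rw [mem_ofPred_eq, h]; exact Summable.mul_left _ hf

/-- The norm of the Sobolev-Zernike space. -/
def normHTilde (s : ℝ) (f : L2Disk) : ℝ := √(∑' n, zernikeTerm s f n)

end
end XrayDisk

open XrayDisk

/-! Both Sobolev norms are weighted ℓ² norms of the coefficients on the orthonormal family `psiHat`
(`mem_sobolev_iff`, `sobolevNorm_sq`), so every claim becomes a comparison of weights. Completeness
of the family plays no role. Since (n+1)² ≤ (n+1)² + (n-2k)², the inclusion in (i) is immediate. It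
is strict because, for n = 0, the weights of T stay equal to 1 while the elliptic ones grow like 4k²
(`HPlus_ne_HT`).

For (ii), the range of `I0` and its closure are orthogonal to ψ_{n,k} whenever k < 0 or k > n. For
the remaining indices |n-2k| ≤ n, hence the elliptic weight is at most twice that of T. The
orthogonality amounts to I₀^*ψ_{n,k} = 0 (`adjoint_I0_psiL2_eq_zero`). To see it, write ψ_{n,k} as a
constant times e^{i(n-2k)θ} cos α U_n(-sin α) with θ = β+α. The factor cos α is the Santaló density,
and -sin α = Im(e^{-iθ}z) at every point z of the line. Thus I₀^*ψ_{n,k}(z) is a multiple of ∫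
e^{i(n-2k)θ} U_n(Im(e^{-iθ}z)) dθ, and the second factor is a trigonometric polynomial of degree at
most n in θ.

For (iii), a chord integral of a ridge polynomial factors explicitly (`integral_chebyshev_chord`),
which makes ψ_{n,k} an eigenvector of I₀I₀^*. The eigenvalue is 2/(n+1) times a Fourier coefficient
of U_n(cos θ), and these coefficients are bounded by 2π. Consequently ‖Z_{n,k}‖² ≤ π/(n+1)
(`norm_sq_adjoint_I0_psiL2_le`). This decay pays for the extra half derivative in the T-scale, and
(ii) carries the estimate over to the elliptic scale. -/

namespace XrayDisk
noncomputable section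

open MeasureTheory Set
open scoped ENNReal Real

/-! ### Series along an orthonormal family. -/

section Hilbert

variable {ι E : Type*} [NormedAddCommGroup E] [InnerProductSpace ℂ E]

lemma summable_smul_iff_of_orthonormal [CompleteSpace E] {v : ι → E} (hv : Orthonormal ℂ v)
    (c : ι → ℂ) : Summable (fun i => c i • v i) ↔ Summable (fun i => ‖c i‖ ^ 2) :=
  hv.orthogonalFamily.summable_iff_norm_sq_summable c

lemma inner_tsum_smul_of_orthonormal {v : ι → E} (hv : Orthonormal ℂ v) {c : ι → ℂ}
    (hc : Summable (fun i => c i • v i)) (i : ι) : inner ℂ (v i) (∑' j, c j • v j) = c i := by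
  classical
  have h := hc.hasSum.mapL (innerSL ℂ (v i))
  refine h.unique ?_
  simp only [innerSL_apply_apply, inner_smul_right, orthonormal_iff_ite.1 hv, mul_ite, mul_one,
    mul_zero]
  have e : (fun j => if i = j then c j else 0) = fun j => if j = i then c i else 0 := by
    funext j
    by_cases hj : i = j
    · subst hj; simp
    · simp [hj, Ne.symm hj]
  rw [e]
  exact hasSum_ite_eq i (c i)

/-- Parseval, obtained by pairing the sum with itself term by term; the family need not be complete.
-/
lemma norm_sq_tsum_smul_of_orthonormal {v : ι → E} (hv : Orthonormal ℂ v) {c : ι → ℂ}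
    (hc : Summable (fun i => c i • v i)) : ‖∑' i, c i • v i‖ ^ 2 = ∑' i, ‖c i‖ ^ 2 := by
  have h := hc.hasSum.mapL (innerSL ℂ (∑' i, c i • v i))
  simp only [innerSL_apply_apply, inner_smul_right] at h
  have e : ∀ i, c i * inner ℂ (∑' j, c j • v j) (v i) = ((‖c i‖ ^ 2 : ℝ) : ℂ) := by
    intro i
    rw [← inner_conj_symm, inner_tsum_smul_of_orthonormal hv hc, RCLike.mul_conj]
    push_cast; rfl
  simp only [e] at h
  rw [inner_self_eq_norm_sq_to_K] at h
  have h2 := h.tsum_eq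
  rw [← Complex.ofReal_tsum] at h2
  refine Complex.ofReal_injective ?_
  rw [h2]; push_cast; rfl

end Hilbert

/-! ### Invariance under the scattering relation. -/

lemma isClosed_L2plus : IsClosed (L2plus : Set L2Fan) := by
  have h : Continuous (LinearMap.id - Lp.compMeasurePreservingₗ ℂ scatter measurePreserving_scatter :
      L2Fan →ₗ[ℂ] L2Fan) := by
    have h2 := (Lp.compMeasurePreservingₗᵢ (E := ℂ) (p := 2) ℂ scatter
      measurePreserving_scatter).continuous
    exact continuous_id.sub h2
  have e : (L2plus : Set L2Fan) = (LinearMap.id - Lp.compMeasurePreservingₗ ℂ scatter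
      measurePreserving_scatter : L2Fan →ₗ[ℂ] L2Fan) ⁻¹' {0} := by
    ext u; simp [L2plus]
  rw [e]
  exact isClosed_singleton.preimage h

lemma toLp_mem_L2plus {f : Fan → ℂ} (hf : MemLp f 2 fanMeasure)
    (h : ∀ p, f (scatter p) = f p) : hf.toLp f ∈ L2plus := by
  have e : f ∘ scatter = f := funext h
  rw [L2plus, LinearMap.mem_ker, LinearMap.sub_apply, LinearMap.id_apply, sub_eq_zero]
  change _ = Lp.compMeasurePreserving scatter measurePreserving_scatter (hf.toLp f)
  rw [Lp.toLp_compMeasurePreserving]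
  simp only [e]

lemma fourier_add_pi (m : ℤ) (b : AddCircle (2 * π)) :
    fourier m (b + ((π : ℝ) : AddCircle (2 * π))) = (-1) ^ m * fourier m b := by
  have h : (fourier m ((π : ℝ) : AddCircle (2 * π)) : ℂ) = (-1) ^ m := by
    rw [fourier_two_pi, ← Complex.exp_pi_mul_I, ← Complex.exp_int_mul]
    ring_nf
  rw [fourier_apply, smul_add, AddCircle.toCircle_add, Circle.coe_mul, ← fourier_apply,
    ← fourier_apply, h, mul_comm]

/-- The relation shifts β+α by π, which produces the sign (-1)^(n-2k) = (-1)^n, and replaces α by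
-α, which swaps the two exponentials. The sign (-1)^n between them makes the two effects cancel. -/
lemma psi_scatter (n : ℕ) (k : ℤ) (p : Fan) : psi n k (scatter p) = psi n k p := by
  have e : p.1 + ((π + 2 * p.2 : ℝ) : AddCircle (2 * π)) + ((-p.2 : ℝ) : AddCircle (2 * π)) =
      p.1 + (p.2 : AddCircle (2 * π)) + ((π : ℝ) : AddCircle (2 * π)) := by
    rw [add_assoc, add_assoc, ← AddCircle.coe_add, ← AddCircle.coe_add]
    congr 2; ring
  have hs : ((-1 : ℂ)) ^ ((n : ℤ) - 2 * k) = (-1) ^ n := by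
    rw [zpow_sub₀ (by norm_num), zpow_mul]; simp
  have h1 : ((-1 : ℂ) ^ n) * (-1) ^ n = 1 := by rw [← mul_pow]; norm_num
  simp only [psi, scatter]
  rw [e, fourier_add_pi, hs]
  push_cast
  simp only [mul_neg, neg_neg]
  linear_combination ((-1) ^ n / (4 * π) : ℂ) * fourier (n - 2 * k) (p.1 + (p.2 : AddCircle (2 * π))) *
    Complex.exp (Complex.I * (n + 1) * p.2) * h1

lemma psiL2_mem_L2plus (n : ℕ) (k : ℤ) : psiL2 n k ∈ L2plus :=
  toLp_mem_L2plus _ (psi_scatter n k)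

/-! ### Orthogonality and normalization of the ψ_{n,k}. -/

lemma integral_fourier (m : ℤ) :
    ∫ b : AddCircle (2 * π), fourier m b = if m = 0 then (2 * π : ℂ) else 0 := by
  have h := orthonormal_iff_ite.1 (orthonormal_fourier (T := 2 * π)) 0 m
  rw [L2.inner_def] at h
  have e : ∫ b : AddCircle (2 * π), fourier m b =
      (2 * π) • ∫ b : AddCircle (2 * π), fourier m b ∂AddCircle.haarAddCircle := by
    rw [AddCircle.volume_eq_smul_haarAddCircle, integral_smul_measure,
      ENNReal.toReal_ofReal (by positivity)]
  rw [e]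
  have e2 : ∫ b : AddCircle (2 * π), fourier m b ∂AddCircle.haarAddCircle = if 0 = m then 1 else 0 := by
    rw [← h]
    refine integral_congr_ae ?_
    filter_upwards [coeFn_fourierLp (T := 2 * π) 2 0, coeFn_fourierLp (T := 2 * π) 2 m] with b h1 h2
    rw [h1, h2]
    simp
  rw [e2]
  simp only [eq_comm (a := (0 : ℤ))]
  split_ifs <;> simp

/-- An even frequency 2q has period dividing π, the length of the interval, when q ≠ 0. -/
lemma integral_exp_even (q : ℤ) :
    ∫ a in Ioo (-(π / 2)) (π / 2), Complex.exp (Complex.I * (2 * q) * a) =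
      if q = 0 then (π : ℂ) else 0 := by
  rw [← integral_Ioc_eq_integral_Ioo, ← intervalIntegral.integral_of_le (by linarith [Real.pi_pos])]
  split_ifs with h
  · subst h
    simp
  · have hq : Complex.I * (2 * q) ≠ 0 := by
      simp [h]
    rw [integral_exp_mul_complex hq]
    have : Complex.exp (Complex.I * (2 * q) * (π / 2 : ℝ)) =
        Complex.exp (Complex.I * (2 * q) * (-(π / 2) : ℝ)) := by
      rw [Complex.exp_eq_exp_iff_exists_int]
      exact ⟨q, by push_cast; ring⟩
    rw [this, sub_self, zero_div]

/-- The factor `e^{i(n+1)α} + (-1)^n e^{-i(n+1)α}` of `ψ_{n,k}`. -/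
def anglePart (n : ℕ) (a : ℝ) : ℂ :=
  Complex.exp (Complex.I * (n + 1) * a) + (-1) ^ n * Complex.exp (-(Complex.I * (n + 1) * a))

lemma psi_eq (n : ℕ) (k : ℤ) (p : Fan) : psi n k p = (-1) ^ n / (4 * π) *
    fourier (n - 2 * k) (p.1 + (p.2 : AddCircle (2 * π))) * anglePart n p.2 := rfl

lemma conj_anglePart (n : ℕ) (a : ℝ) :
    (starRingEnd ℂ) (anglePart n a) = (-1) ^ n * anglePart n a := by
  have h1 : ((-1 : ℂ) ^ n) * (-1) ^ n = 1 := by rw [← mul_pow]; norm_num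
  unfold anglePart
  simp only [map_add, map_mul, map_pow, map_neg, map_one, ← Complex.exp_conj, Complex.conj_I,
    Complex.conj_ofReal, Complex.conj_natCast, neg_mul, neg_neg]
  linear_combination (-Complex.exp (-(Complex.I * (n + 1) * a))) * h1

/-- Equal parity of the degrees is what turns all product frequencies into even ones, for which
exponentials are orthogonal on an interval of length π. Nothing more is needed: the β-integral
already forces n and n' to have the same parity. -/
lemma integral_anglePart {n n' : ℕ} {d : ℤ} (h : (n' : ℤ) = n + 2 * d) :
    ∫ a in Ioo (-(π / 2)) (π / 2), (starRingEnd ℂ) (anglePart n a) * anglePart n' a =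
      if n = n' then (2 * π : ℂ) else 0 := by
  have h1 : ((-1 : ℂ) ^ n) * (-1) ^ n = 1 := by rw [← mul_pow]; norm_num
  have h2 : ((-1 : ℂ)) ^ n' = (-1) ^ n := by
    rw [← zpow_natCast, h, zpow_add₀ (by norm_num), zpow_mul]; simp
  have hc : (n' : ℂ) = n + 2 * d := by exact_mod_cast h
  have e : ∀ a : ℝ, (starRingEnd ℂ) (anglePart n a) * anglePart n' a =
      (-1) ^ n * Complex.exp (Complex.I * (2 * (n + 1 + d : ℤ)) * a) +
      (-1) ^ n * Complex.exp (Complex.I * (2 * (-(n + 1 + d) : ℤ)) * a) +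
      (Complex.exp (Complex.I * (2 * (d : ℤ)) * a) +
      Complex.exp (Complex.I * (2 * (-d : ℤ)) * a)) := by
    intro a
    have e1 : Complex.exp (Complex.I * (2 * (n + 1 + d : ℤ)) * a) =
      Complex.exp (Complex.I * (n + 1) * a) * Complex.exp (Complex.I * (n' + 1) * a) := by
      rw [← Complex.exp_add, hc]; push_cast; ring_nf
    have e2 : Complex.exp (Complex.I * (2 * (-(n + 1 + d) : ℤ)) * a) =
      Complex.exp (-(Complex.I * (n + 1) * a)) * Complex.exp (-(Complex.I * (n' + 1) * a)) := by
      rw [← Complex.exp_add, hc]; push_cast; ring_nf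
    have e3 : Complex.exp (Complex.I * (2 * (d : ℤ)) * a) =
      Complex.exp (-(Complex.I * (n + 1) * a)) * Complex.exp (Complex.I * (n' + 1) * a) := by
      rw [← Complex.exp_add, hc]; ring_nf
    have e4 : Complex.exp (Complex.I * (2 * (-d : ℤ)) * a) =
      Complex.exp (Complex.I * (n + 1) * a) * Complex.exp (-(Complex.I * (n' + 1) * a)) := by
      rw [← Complex.exp_add, hc]; push_cast; ring_nf
    rw [conj_anglePart, e1, e2, e3, e4]
    unfold anglePart
    rw [h2]
    linear_combination (Complex.exp (Complex.I * (n + 1) * a) * Complex.exp (-(Complex.I * (n' + 1) * a))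
      + Complex.exp (-(Complex.I * (n + 1) * a)) * Complex.exp (Complex.I * (n' + 1) * a) +
      (-1) ^ n * Complex.exp (-(Complex.I * (n + 1) * a)) *
        Complex.exp (-(Complex.I * (n' + 1) * a))) * h1
  have hi : ∀ q : ℤ, Integrable (fun a : ℝ => Complex.exp (Complex.I * (2 * q) * a))
      (volume.restrict (Ioo (-(π / 2)) (π / 2))) := by
    intro q
    exact ((show Continuous (fun a : ℝ => Complex.exp (Complex.I * (2 * q) * a)) by
      fun_prop).integrableOn_Icc).mono_set Ioo_subset_Icc_self
  simp only [e]
  rw [integral_add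
    (f := fun a : ℝ => (-1) ^ n * Complex.exp (Complex.I * (2 * (n + 1 + d : ℤ)) * a) +
      (-1) ^ n * Complex.exp (Complex.I * (2 * (-(n + 1 + d) : ℤ)) * a))
    (g := fun a : ℝ => Complex.exp (Complex.I * (2 * (d : ℤ)) * a) +
      Complex.exp (Complex.I * (2 * (-d : ℤ)) * a))
    (((hi _).const_mul _).add ((hi _).const_mul _)) ((hi _).add (hi _)),
    integral_add ((hi _).const_mul _) ((hi _).const_mul _), integral_add (hi _) (hi _),
    integral_const_mul, integral_const_mul, integral_exp_even, integral_exp_even,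
    integral_exp_even, integral_exp_even]
  -- n+1+d is half of n+n'+2, hence positive: the sum frequencies never vanish and only the
  -- difference frequencies ±2d can contribute.
  have hne : (n : ℤ) + 1 + d ≠ 0 := by omega
  have hne' : -((n : ℤ) + 1 + d) ≠ 0 := by omega
  rw [if_neg hne, if_neg hne']
  by_cases hd : d = 0
  · have : n = n' := by omega
    simp [hd, this]; ring
  · have : n ≠ n' := by omega
    simp [hd, this]

lemma inner_psiL2_eq_integral (n : ℕ) (k : ℤ) (u : L2Fan) :
    inner ℂ (psiL2 n k) u = ∫ p, (starRingEnd ℂ) (psi n k p) * u p ∂fanMeasure := by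
  rw [L2.inner_def]
  refine integral_congr_ae ?_
  filter_upwards [(memLp_psi n k).coeFn_toLp] with p hp
  rw [psiL2, hp, RCLike.inner_apply, mul_comm]

lemma inner_psiL2 (n n' : ℕ) (k k' : ℤ) :
    inner ℂ (psiL2 n k) (psiL2 n' k') = if n = n' ∧ k = k' then (1 / 4 : ℂ) else 0 := by
  rw [inner_psiL2_eq_integral]
  have e : ∀ᵐ p ∂fanMeasure, (starRingEnd ℂ) (psi n k p) * psiL2 n' k' p =
      (fun p : Fan => (starRingEnd ℂ) (psi n k p) * psi n' k' p) p := by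
    filter_upwards [(memLp_psi n' k').coeFn_toLp] with p hp
    rw [psiL2, hp]
  rw [integral_congr_ae e]
  have hint : Integrable (fun p : Fan => (starRingEnd ℂ) (psi n k p) * psi n' k' p) fanMeasure :=
    (memLp_psi n k).star.integrable_mul (memLp_psi n' k')
  unfold fanMeasure at hint ⊢
  rw [integral_prod_symm _ hint]
  -- For fixed α, translating β by α separates the variables θ = β+α and α.
  have inner_int : ∀ a : ℝ, ∫ b : AddCircle (2 * π), (starRingEnd ℂ) (psi n k (b, a)) * psi n' k' (b, a)
      = ((-1) ^ n / (4 * π) * ((-1) ^ n' / (4 * π)) *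
        (if ((n' : ℤ) - 2 * k') - (n - 2 * k) = 0 then (2 * π : ℂ) else 0)) *
        ((starRingEnd ℂ) (anglePart n a) * anglePart n' a) := by
    intro a
    rw [← integral_fourier, ← integral_add_right_eq_self (fun b => fourier _ b) (a : AddCircle (2 * π)),
      ← integral_const_mul, ← integral_mul_const]
    refine integral_congr_ae (Filter.Eventually.of_forall fun b => ?_)
    have hf : (fourier (((n' : ℤ) - 2 * k') - (n - 2 * k)) (b + (a : AddCircle (2 * π))) : ℂ) =
        (starRingEnd ℂ) (fourier (n - 2 * k) (b + (a : AddCircle (2 * π)))) *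
          fourier (n' - 2 * k') (b + (a : AddCircle (2 * π))) := by
      rw [← fourier_neg, ← fourier_add]; congr 2; ring
    have hc : (starRingEnd ℂ) ((-1) ^ n / (4 * π) : ℂ) = (-1) ^ n / (4 * π) := by
      simp [Complex.conj_ofNat]
    simp only [psi_eq, map_mul, hf, hc]
    ring
  simp only [inner_int]
  rw [integral_const_mul]
  by_cases hm : ((n' : ℤ) - 2 * k') - (n - 2 * k) = 0
  · rw [if_pos hm, integral_anglePart (d := k' - k) (by omega)]
    by_cases hn : n = n'
    · subst hn
      have hk : k = k' := by omega
      subst hk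
      have h1 : ((-1 : ℂ) ^ n) * (-1) ^ n = 1 := by rw [← mul_pow]; norm_num
      have : (π : ℂ) ≠ 0 := by exact_mod_cast Real.pi_ne_zero
      simp only [if_true, and_self]
      field_simp
      linear_combination 4 * h1
    · simp [hn]
  · have : ¬ (n = n' ∧ k = k') := by
      rintro ⟨rfl, rfl⟩; simp at hm
    rw [if_neg hm, if_neg this]; simp

lemma norm_psiL2 (n : ℕ) (k : ℤ) : ‖psiL2 n k‖ = 1 / 2 := by
  have h := inner_psiL2 n n k k
  rw [inner_self_eq_norm_sq_to_K, if_pos ⟨rfl, rfl⟩] at h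
  have h2 : ‖psiL2 n k‖ ^ 2 = 1 / 4 := by
    apply Complex.ofReal_injective; push_cast; exact h
  nlinarith [norm_nonneg (psiL2 n k)]

lemma psiHat_eq (n : ℕ) (k : ℤ) : psiHat n k = (2 : ℂ) • psiL2 n k := by
  rw [psiHat, norm_psiL2]; norm_num

lemma orthonormal_psiHat : Orthonormal ℂ (fun nk : ℕ × ℤ => psiHat nk.1 nk.2) := by
  rw [orthonormal_iff_ite]
  rintro ⟨n, k⟩ ⟨n', k'⟩
  simp only [psiHat_eq, inner_smul_left, inner_smul_right, inner_psiL2, Prod.mk.injEq]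
  split_ifs
  · rw [map_ofNat]; norm_num
  · simp

lemma psiHat_mem_L2plus (n : ℕ) (k : ℤ) : psiHat n k ∈ L2plus :=
  L2plus.smul_mem _ (psiL2_mem_L2plus n k)

lemma tsum_psiHat_mem_L2plus (c : ℕ × ℤ → ℂ) :
    ∑' nk, c nk • psiHat nk.1 nk.2 ∈ L2plus := by
  exact tsum_mem isClosed_L2plus fun nk => L2plus.smul_mem _ (psiHat_mem_L2plus _ _)

/-! ### Sobolev norms as weighted sums of coefficients. -/

namespace DiagonalOperator

/-- The term `λ_{n,k}^s |⟨u, ψ̂_{n,k}⟩|²` of the squared Sobolev norm. -/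
def normTerm (P : DiagonalOperator) (s : ℝ) (u : L2Fan) (nk : ℕ × ℤ) : ℝ :=
  P.eigenvalue nk.1 nk.2 ^ s * ‖inner ℂ (psiHat nk.1 nk.2) u‖ ^ 2

variable {P : DiagonalOperator}

lemma normTerm_nonneg (hP : ∀ n k, 0 ≤ P.eigenvalue n k) (s : ℝ) (u : L2Fan) (nk : ℕ × ℤ) :
    0 ≤ P.normTerm s u nk :=
  mul_nonneg (Real.rpow_nonneg (hP _ _) _) (sq_nonneg _)

lemma norm_sq_power_coeff (hP : ∀ n k, 0 ≤ P.eigenvalue n k) (s : ℝ) (u : L2Fan) (nk : ℕ × ℤ) :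
    ‖((P.eigenvalue nk.1 nk.2 ^ (s / 2) : ℝ) : ℂ) * inner ℂ (psiHat nk.1 nk.2) u‖ ^ 2 =
      P.normTerm s u nk := by
  rw [norm_mul, mul_pow, Complex.norm_real, Real.norm_eq_abs, sq_abs, ← Real.rpow_natCast,
    ← Real.rpow_mul (hP _ _), normTerm]
  norm_num

/-- The requirement that the power lie in `L2plus` is automatic: its series has terms in a closed
subspace. -/
lemma mem_sobolev_iff (hP : ∀ n k, 0 ≤ P.eigenvalue n k) {s : ℝ} {u : L2Fan} :
    u ∈ P.sobolev s ↔ u ∈ L2plus ∧ Summable (P.normTerm s u) := by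
  have h := summable_smul_iff_of_orthonormal orthonormal_psiHat
    (fun nk => ((P.eigenvalue nk.1 nk.2 ^ (s / 2) : ℝ) : ℂ) * inner ℂ (psiHat nk.1 nk.2) u)
  simp only [norm_sq_power_coeff hP] at h
  change _ ∧ Summable _ ∧ _ ↔ _
  refine and_congr_right fun _ => ⟨fun h2 => h.1 h2.1, fun h2 => ⟨h.2 h2, ?_⟩⟩
  exact tsum_psiHat_mem_L2plus _

lemma sobolevNorm_sq (hP : ∀ n k, 0 ≤ P.eigenvalue n k) {s : ℝ} {u : L2Fan}
    (hu : u ∈ P.sobolev s) : P.sobolevNorm s u ^ 2 = ∑' nk, P.normTerm s u nk := by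
  have h := norm_sq_tsum_smul_of_orthonormal orthonormal_psiHat hu.2.1
  simp only [norm_sq_power_coeff hP] at h
  exact h

end DiagonalOperator

lemma negTSq_eigenvalue_nonneg (n : ℕ) (k : ℤ) : 0 ≤ negTSq.eigenvalue n k := by
  simp only [negTSq]; positivity

lemma negEllip_eigenvalue_nonneg (n : ℕ) (k : ℤ) : 0 ≤ negEllip.eigenvalue n k := by
  simp only [negEllip]; positivity

/-! ### The Santaló formula with the direction of the line retained. -/

instance : IsFiniteMeasure diskMeasure := by
  unfold diskMeasure
  exact ⟨by rw [Measure.restrict_apply_univ]; exact (isCompact_closedBall 0 1).measure_lt_top⟩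

/-- The map from a line with a parameter `t` on it to its direction angle `β + α` and the point of
the disk at parameter `t`. -/
def lineMap (q : Fan × ℝ) : AddCircle (2 * π) × ℂ :=
  (q.1.1 + (q.1.2 : AddCircle (2 * π)), geodesic q.1 q.2)

/-- The measure `cos α dβ dα dt` on the lines through the disk with a marked point. -/
def lineMeasure : Measure (Fan × ℝ) :=
  ((fanMeasure.prod volume).restrict {q : Fan × ℝ | q.2 ∈ Ioc 0 (exitTime q.1)}).withDensity
    fun q => ((Real.cos q.1.2).toNNReal : ℝ≥0∞)

lemma measurable_lineMap : Measurable lineMap :=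
  ((measurable_fst.comp measurable_fst).add
    (measurable_coe_addCircle.comp (measurable_snd.comp measurable_fst))).prodMk measurable_geodesic

/-- For a fixed direction θ = β+α, the parallel lines with offsets -sin α sweep out the disk with
density cos α. This is the slicing formula `lintegral_fan_slice` after a rotation by θ. Keeping θ as
a variable permits weights that depend on the direction, as needed for the adjoint. -/
lemma lintegral_lineMap (G : AddCircle (2 * π) × ℂ → ℝ≥0∞) (hG : Measurable G) :
    ∫⁻ p, ENNReal.ofReal (Real.cos p.2) *
      (∫⁻ t in Ioc 0 (exitTime p), G (lineMap (p, t))) ∂fanMeasure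
    = ∫⁻ q, G q ∂((volume : Measure (AddCircle (2 * π))).prod diskMeasure) := by
  have hm : Measurable (fun p : Fan => ENNReal.ofReal (Real.cos p.2) *
      (∫⁻ t in Ioc 0 (exitTime p), G (lineMap (p, t)))) := by
    refine Measurable.mul (by fun_prop) ?_
    simp_rw [← lintegral_indicator measurableSet_Ioc]
    have h : Measurable ({q : Fan × ℝ | q.2 ∈ Ioc 0 (exitTime q.1)}.indicator
      (fun q => G (lineMap q))) := (hG.comp measurable_lineMap).indicator measurable_lineSet
    exact h.lintegral_prod_right'
  have hsh : Measurable (fun p : Fan => (p.1 - (p.2 : AddCircle (2 * π)), p.2)) :=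
    (measurable_fst.sub (measurable_coe_addCircle.comp measurable_snd)).prodMk measurable_snd
  rw [lintegral_prod _ hG.aemeasurable]
  unfold fanMeasure
  rw [lintegral_prod_symm' _ hm]
  -- With β = θ - α the direction is exactly θ, so Tonelli can exchange α and θ.
  have e0 : ∀ (b : AddCircle (2 * π)) (a t : ℝ), lineMap ((b - (a : AddCircle (2 * π)), a), t) =
      (b, (AddCircle.toCircle b : ℂ) * (Complex.exp (-(Complex.I * a)) - t)) := by
    intro b a t
    simp only [lineMap, geodesic_shift, sub_add_cancel]
  have e1 : ∀ a : ℝ, ∫⁻ b : AddCircle (2 * π), ENNReal.ofReal (Real.cos a) *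
      (∫⁻ t in Ioc 0 (exitTime (b, a)), G (lineMap ((b, a), t))) =
      ∫⁻ b : AddCircle (2 * π), ENNReal.ofReal (Real.cos a) *
      (∫⁻ t in Ioc 0 (2 * Real.cos a),
        G (b, (AddCircle.toCircle b : ℂ) * (Complex.exp (-(Complex.I * a)) - t))) := by
    intro a
    rw [← lintegral_sub_right_eq_self _ (a : AddCircle (2 * π))]
    simp only [e0]
    rfl
  simp only [e1]
  have hm2 := hm.comp hsh
  simp only [Function.comp_def, e0, exitTime] at hm2
  rw [lintegral_lintegral_swap (f := fun a b => ENNReal.ofReal (Real.cos a) *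
      (∫⁻ t in Ioc 0 (2 * Real.cos a),
        G (b, (AddCircle.toCircle b : ℂ) * (Complex.exp (-(Complex.I * a)) - t))))
    (hm2.comp measurable_swap).aemeasurable]
  refine lintegral_congr fun b => ?_
  have hGb : Measurable fun z => G (b, z) := hG.comp measurable_prodMk_left
  rw [← lintegral_disk_rotate (fun z => G (b, z)) hGb (AddCircle.toCircle b)]
  exact lintegral_fan_slice (fun z => G (b, (AddCircle.toCircle b : ℂ) * z)) (by fun_prop)

lemma measurable_cos_angle : Measurable fun q : Fan × ℝ => (Real.cos q.1.2).toNNReal := by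
  fun_prop

/-- Recasting the nonnegative formula as preservation of measure gives the version for complex
integrands, `integral_lineMap`, by general theory. -/
lemma measurePreserving_lineMap : MeasurePreserving lineMap lineMeasure
    ((volume : Measure (AddCircle (2 * π))).prod diskMeasure) := by
  refine ⟨measurable_lineMap, Measure.ext_of_lintegral _ fun G hG => ?_⟩
  have hGm : Measurable fun q => G (lineMap q) := hG.comp measurable_lineMap
  rw [lintegral_map hG measurable_lineMap, lineMeasure, lintegral_withDensity_eq_lintegral_mul _
    measurable_cos_angle.coe_nnreal_ennreal hGm, ← lintegral_indicator measurable_lineSet,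
    lintegral_prod _ (((measurable_cos_angle.coe_nnreal_ennreal.mul hGm).indicator
      measurable_lineSet).aemeasurable), ← lintegral_lineMap G hG]
  refine lintegral_congr fun p => ?_
  rw [← lintegral_const_mul _ (show Measurable fun t => G (lineMap (p, t)) from
    hGm.comp measurable_prodMk_left), ← lintegral_indicator measurableSet_Ioc]
  rfl

lemma integral_lineMap {h : AddCircle (2 * π) × ℂ → ℂ}
    (hh : Integrable h ((volume : Measure (AddCircle (2 * π))).prod diskMeasure)) :
    ∫ q, h q ∂((volume : Measure (AddCircle (2 * π))).prod diskMeasure) =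
      ∫ p, (Real.cos p.2 : ℂ) * (∫ t in (0 : ℝ)..exitTime p, h (lineMap (p, t))) ∂fanMeasure := by
  have hmp := measurePreserving_lineMap
  have hi : Integrable (fun q => h (lineMap q)) lineMeasure := hmp.integrable_comp_of_integrable hh
  rw [← hmp.map_eq, integral_map hmp.measurable.aemeasurable (by rw [hmp.map_eq]; exact hh.1)]
  unfold lineMeasure at hi ⊢
  rw [integrable_withDensity_iff_integrable_smul measurable_cos_angle] at hi
  rw [integral_withDensity_eq_integral_smul measurable_cos_angle,
    ← integral_indicator measurable_lineSet, integral_prod _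
      ((integrable_indicator_iff measurable_lineSet).2 hi)]
  refine integral_congr_ae ?_
  filter_upwards [ae_cos_pos] with p hp
  have h0 : 0 ≤ exitTime p := by unfold exitTime; positivity
  rw [intervalIntegral.integral_of_le h0, ← integral_const_mul,
    ← integral_indicator measurableSet_Ioc]
  refine integral_congr_ae (Filter.Eventually.of_forall fun t => ?_)
  simp only [indicator, mem_ofPred_eq]
  split_ifs
  · rw [NNReal.smul_def, Real.coe_toNNReal _ hp.le, Complex.real_smul]
  · rfl

/-! ### The adjoint as a superposition of ridge polynomials. -/

/-- The ridge polynomial `z ↦ U_n(Im(e^{-iθ}z))` with the Chebyshev polynomial `U_n`. -/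
def ridge (n : ℕ) (θ : AddCircle (2 * π)) (z : ℂ) : ℝ :=
  (Polynomial.Chebyshev.U ℝ n).eval ((starRingEnd ℂ) (AddCircle.toCircle θ : ℂ) * z).im

lemma continuous_toCircle : Continuous fun θ : AddCircle (2 * π) => (AddCircle.toCircle θ : ℂ) := by
  have h := (fourier (T := 2 * π) 1).continuous
  exact h.congr fun θ => fourier_one

lemma continuous_ridge (n : ℕ) : Continuous fun q : AddCircle (2 * π) × ℂ => ridge n q.1 q.2 := by
  unfold ridge
  refine (Polynomial.Chebyshev.U ℝ n).continuous.comp (Complex.continuous_im.comp ?_)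
  exact (Complex.continuous_conj.comp (continuous_toCircle.comp continuous_fst)).mul continuous_snd

lemma toCircle_mul_conj (θ : AddCircle (2 * π)) :
    (starRingEnd ℂ) (AddCircle.toCircle θ : ℂ) * AddCircle.toCircle θ = 1 := by
  rw [← Complex.normSq_eq_conj_mul_self, Circle.normSq_coe, Complex.ofReal_one]

lemma exp_neg_I_mul (a : ℝ) :
    Complex.exp (-(Complex.I * a)) = Real.cos a - Real.sin a * Complex.I := by
  have : -(Complex.I * a) = ((-a : ℝ) : ℂ) * Complex.I := by push_cast; ring
  rw [this, Complex.exp_mul_I]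
  push_cast
  rw [Complex.cos_neg, Complex.sin_neg]
  ring

lemma geodesic_eq (p : Fan) (t : ℝ) : geodesic p t =
    (AddCircle.toCircle (p.1 + (p.2 : AddCircle (2 * π))) : ℂ) *
      ((Real.cos p.2 - t : ℝ) - Real.sin p.2 * Complex.I) := by
  have h := geodesic_shift (p.1 + (p.2 : AddCircle (2 * π))) p.2 t
  rw [add_sub_cancel_right, exp_neg_I_mul] at h
  rw [h]; push_cast; ring

/-- Along a line with direction angle θ, Im(e^{-iθ}z) is the signed distance to the origin, so the
ridge polynomial does not depend on t and can leave the line integral. -/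
lemma ridge_lineMap (n : ℕ) (q : Fan × ℝ) : ridge n (lineMap q).1 (lineMap q).2 =
    (Polynomial.Chebyshev.U ℝ n).eval (-Real.sin q.1.2) := by
  unfold ridge lineMap
  simp only
  rw [geodesic_eq, ← mul_assoc, toCircle_mul_conj, one_mul]
  simp [-Complex.ofReal_sin]

/-- This is U_n(cos x) sin x = sin((n+1)x) at x = α + π/2, where cos x = -sin α and sin x = cos α.
-/
lemma anglePart_eq (n : ℕ) (a : ℝ) : anglePart n a = 2 * (-Complex.I) ^ n *
    (Real.cos a * (Polynomial.Chebyshev.U ℝ n).eval (-Real.sin a) : ℝ) := by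
  have h := Polynomial.Chebyshev.U_real_cos (a + π / 2) n
  rw [Real.cos_add_pi_div_two, Real.sin_add_pi_div_two] at h
  rw [mul_comm (Real.cos a), h, Complex.ofReal_sin, Complex.sin]
  have h1 : Complex.exp (-(((n : ℤ) + 1) * (a + π / 2) : ℝ) * Complex.I) =
      (-Complex.I) ^ (n + 1) * Complex.exp (-(Complex.I * (n + 1) * a)) := by
    rw [← Complex.exp_neg_pi_div_two_mul_I, ← Complex.exp_nat_mul, ← Complex.exp_add]
    push_cast; ring_nf
  have h2 : Complex.exp ((((n : ℤ) + 1) * (a + π / 2) : ℝ) * Complex.I) =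
      Complex.I ^ (n + 1) * Complex.exp (Complex.I * (n + 1) * a) := by
    have hI : Complex.I ^ (n + 1) = Complex.exp ((n + 1 : ℕ) * (π / 2 * Complex.I)) := by
      rw [Complex.exp_nat_mul, Complex.exp_pi_div_two_mul_I]
    rw [hI, ← Complex.exp_add]
    push_cast; ring_nf
  rw [h1, h2, anglePart]
  have h3 : (-Complex.I) ^ n * Complex.I ^ n = 1 := by
    rw [← mul_pow]; simp
  have h4 : (-Complex.I) ^ n * (-Complex.I) ^ n = (-1) ^ n := by
    rw [← mul_pow]; simp
  linear_combination (-Complex.exp (Complex.I * (n + 1) * a)) * h3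
    - Complex.exp (-(Complex.I * (n + 1) * a)) * h4
    + ((-Complex.I) ^ n * (-Complex.I) ^ n * Complex.exp (-(Complex.I * (n + 1) * a)) +
      (-Complex.I) ^ n * Complex.I ^ n * Complex.exp (Complex.I * (n + 1) * a)) * Complex.I_sq

/-- The constant `i^n / (2π)`, with `ψ_{n,k} = i^n/(2π) e^{i(n-2k)(β+α)} cos α U_n(-sin α)`. -/
def psiConst (n : ℕ) : ℂ := Complex.I ^ n / (2 * π)

lemma psi_eq_chebyshev (n : ℕ) (k : ℤ) (p : Fan) : psi n k p = psiConst n *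
    fourier (n - 2 * k) (p.1 + (p.2 : AddCircle (2 * π))) *
      (Real.cos p.2 * (Polynomial.Chebyshev.U ℝ n).eval (-Real.sin p.2) : ℝ) := by
  rw [psi_eq, anglePart_eq, psiConst]
  have h : (-1 : ℂ) ^ n * (-Complex.I) ^ n = Complex.I ^ n := by
    rw [← mul_pow]; simp
  rw [← h]
  ring

/-- The function `z ↦ i^n/(2π) ∫ e^{imθ} U_n(Im(e^{-iθ}z)) dθ`. -/
def zernikeFun (n : ℕ) (m : ℤ) (z : ℂ) : ℂ :=
  psiConst n * ∫ θ : AddCircle (2 * π), fourier m θ * ridge n θ z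

lemma continuous_zernikeKernel (n : ℕ) (m : ℤ) :
    Continuous fun q : AddCircle (2 * π) × ℂ => (fourier m q.1 * ridge n q.1 q.2 : ℂ) :=
  ((fourier m).continuous.comp continuous_fst).mul
    (Complex.continuous_ofReal.comp (continuous_ridge n))

lemma continuous_zernikeFun (n : ℕ) (m : ℤ) : Continuous (zernikeFun n m) := by
  have h := continuous_parametric_integral_of_continuous
    (μ := (volume : Measure (AddCircle (2 * π)))) (s := univ)
    (f := fun (z : ℂ) (θ : AddCircle (2 * π)) => (fourier m θ * ridge n θ z : ℂ))
    ((continuous_zernikeKernel n m).comp continuous_swap) isCompact_univ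
  simp only [Measure.restrict_univ] at h
  exact continuous_const.mul h

lemma ae_mem_disk : ∀ᵐ z ∂diskMeasure, z ∈ Metric.closedBall (0 : ℂ) 1 :=
  ae_restrict_mem Metric.isClosed_closedBall.measurableSet

lemma memLp_disk_of_continuous {F : ℂ → ℂ} (hF : Continuous F) : MemLp F 2 diskMeasure := by
  obtain ⟨C, hC⟩ := (isCompact_closedBall (0 : ℂ) 1).exists_bound_of_continuousOn hF.continuousOn
  exact MemLp.of_bound hF.aestronglyMeasurable C (ae_mem_disk.mono hC)

lemma integrable_zernikeKernel_mul (n : ℕ) (m : ℤ) (f : L2Disk) :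
    Integrable (fun q : AddCircle (2 * π) × ℂ =>
      (starRingEnd ℂ) (fourier m q.1 * ridge n q.1 q.2 : ℂ) * f q.2)
      ((volume : Measure (AddCircle (2 * π))).prod diskMeasure) := by
  have hf : Integrable (f : ℂ → ℂ) diskMeasure := (Lp.memLp f).integrable (by norm_num)
  obtain ⟨C, hC⟩ := (isCompact_univ.prod (isCompact_closedBall (0 : ℂ) 1)).exists_bound_of_continuousOn
    (continuous_zernikeKernel n m).continuousOn
  refine (hf.comp_snd (volume : Measure (AddCircle (2 * π)))).bdd_mul (c := C)
    (Complex.continuous_conj.comp (continuous_zernikeKernel n m)).aestronglyMeasurable ?_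
  filter_upwards [Measure.quasiMeasurePreserving_snd.ae ae_mem_disk] with q hq
  rw [RCLike.norm_conj]
  exact hC q ⟨mem_univ _, hq⟩

/-- The factor cos α in ψ_{n,k} is the density in `integral_lineMap`, and the rest of ψ_{n,k} is a
function of the line alone that extends to the kernel e^{imθ}U_n(Im(e^{-iθ}z)) on pairs (θ, z). -/
lemma inner_psiL2_I0 (n : ℕ) (k : ℤ) (f : L2Disk) :
    inner ℂ (psiL2 n k) (I0 f) =
      ∫ z, (starRingEnd ℂ) (zernikeFun n (n - 2 * k) z) * f z ∂diskMeasure := by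
  have hi := integrable_zernikeKernel_mul n (n - 2 * k) f
  have h1 : ∫ z, (starRingEnd ℂ) (zernikeFun n (n - 2 * k) z) * f z ∂diskMeasure =
      (starRingEnd ℂ) (psiConst n) * ∫ q : AddCircle (2 * π) × ℂ,
        (starRingEnd ℂ) (fourier (n - 2 * k) q.1 * ridge n q.1 q.2 : ℂ) * f q.2
        ∂((volume : Measure (AddCircle (2 * π))).prod diskMeasure) := by
    rw [integral_prod_symm _ hi, ← integral_const_mul]
    refine integral_congr_ae (Filter.Eventually.of_forall fun z => ?_)
    simp only [zernikeFun, map_mul]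
    rw [integral_mul_const, ← integral_conj]
    simp only [map_mul]
    ring
  rw [h1, integral_lineMap hi, inner_psiL2_eq_integral, ← integral_const_mul]
  refine integral_congr_ae ?_
  filter_upwards [coeFn_I0 f] with p hp
  rw [hp, psi_eq_chebyshev]
  unfold xray
  rw [← intervalIntegral.integral_const_mul, ← intervalIntegral.integral_const_mul,
    ← intervalIntegral.integral_const_mul]
  refine intervalIntegral.integral_congr fun t _ => ?_
  simp only [ridge_lineMap]
  simp only [lineMap, map_mul, Complex.conj_ofReal]
  push_cast
  ring

lemma adjoint_I0_psiL2 (n : ℕ) (k : ℤ) : ContinuousLinearMap.adjoint I0 (psiL2 n k) =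
    (memLp_disk_of_continuous (continuous_zernikeFun n (n - 2 * k))).toLp _ := by
  refine ext_inner_right ℂ fun f => ?_
  rw [ContinuousLinearMap.adjoint_inner_left, inner_psiL2_I0, L2.inner_def]
  refine integral_congr_ae ?_
  filter_upwards [(memLp_disk_of_continuous (continuous_zernikeFun n (n - 2 * k))).coeFn_toLp]
    with z hz
  rw [hz, RCLike.inner_apply, mul_comm]

/-! ### Vanishing of the adjoint outside 0 ≤ k ≤ n. -/

lemma integrable_circle_of_continuous {F : AddCircle (2 * π) → ℂ} (hF : Continuous F) :
    Integrable F :=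
  integrableOn_univ.1 (hF.continuousOn.integrableOn_compact isCompact_univ)

lemma integral_fourier_mul_pow (a b : ℂ) (j : ℕ) (m : ℤ) (h : (j : ℤ) < |m|) :
    ∫ θ : AddCircle (2 * π), fourier m θ * (a * fourier (-1) θ + b * fourier 1 θ) ^ j = 0 := by
  induction j generalizing m with
  | zero =>
    have hm : m ≠ 0 := by rintro rfl; simp at h
    simp only [pow_zero, mul_one, integral_fourier, if_neg hm]
  | succ j ih =>
    have e : ∀ θ : AddCircle (2 * π),
        fourier m θ * (a * fourier (-1) θ + b * fourier 1 θ) ^ (j + 1) =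
        a * (fourier (m + -1) θ * (a * fourier (-1) θ + b * fourier 1 θ) ^ j) +
        b * (fourier (m + 1) θ * (a * fourier (-1) θ + b * fourier 1 θ) ^ j) := by
      intro θ
      rw [fourier_add, fourier_add]
      ring
    simp only [e]
    -- One factor shifts the frequency by ±1, so |m ± 1| ≥ |m| - 1 still exceeds the remaining
    -- exponent.
    rw [integral_add (integrable_circle_of_continuous (by fun_prop))
      (integrable_circle_of_continuous (by fun_prop)), integral_const_mul, integral_const_mul,
      ih _ (by push_cast at h; rw [lt_abs] at h ⊢; omega),
      ih _ (by push_cast at h; rw [lt_abs] at h ⊢; omega)]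
    simp

lemma integral_fourier_mul_eval (P : Polynomial ℂ) (a b : ℂ) (m : ℤ) (h : (P.natDegree : ℤ) < |m|) :
    ∫ θ : AddCircle (2 * π), fourier m θ * P.eval (a * fourier (-1) θ + b * fourier 1 θ) = 0 := by
  simp only [Polynomial.eval_eq_sum_range, Finset.mul_sum]
  rw [integral_finsetSum _ fun j _ => integrable_circle_of_continuous (by fun_prop)]
  refine Finset.sum_eq_zero fun j hj => ?_
  have e : ∀ θ : AddCircle (2 * π),
      fourier m θ * (P.coeff j * (a * fourier (-1) θ + b * fourier 1 θ) ^ j) =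
      P.coeff j * (fourier m θ * (a * fourier (-1) θ + b * fourier 1 θ) ^ j) := fun θ => by ring
  simp only [e]
  rw [integral_const_mul, integral_fourier_mul_pow _ _ _ _ (by rw [Finset.mem_range] at hj; omega),
    mul_zero]

lemma fourier_neg_one_eq (θ : AddCircle (2 * π)) :
    (fourier (-1) θ : ℂ) = (starRingEnd ℂ) (AddCircle.toCircle θ : ℂ) := by
  rw [fourier_neg, fourier_one]

/-- Im w = (w - w̄)/(2i) with w = e^{-iθ}z exhibits the ridge as a polynomial in a combination of
e^{-iθ} and e^{iθ}, so its degree bounds the frequencies in θ. -/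
lemma ofReal_ridge (n : ℕ) (θ : AddCircle (2 * π)) (z : ℂ) : (ridge n θ z : ℂ) =
    (Polynomial.Chebyshev.U ℂ n).eval
      (z / (2 * Complex.I) * fourier (-1) θ + -(starRingEnd ℂ) z / (2 * Complex.I) * fourier 1 θ) := by
  rw [ridge, Polynomial.Chebyshev.complex_ofReal_eval_U, Complex.im_eq_sub_conj, fourier_neg_one_eq,
    fourier_one, map_mul, Complex.conj_conj]
  congr 1
  ring

lemma zernikeFun_eq_zero (n : ℕ) (m : ℤ) (h : (n : ℤ) < |m|) (z : ℂ) : zernikeFun n m z = 0 := by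
  simp only [zernikeFun, ofReal_ridge]
  rw [integral_fourier_mul_eval _ _ _ _ (by
    rwa [Polynomial.Chebyshev.natDegree_U_natCast]), mul_zero]

lemma adjoint_I0_psiL2_eq_zero (n : ℕ) (k : ℤ) (hk : k < 0 ∨ (n : ℤ) < k) :
    ContinuousLinearMap.adjoint I0 (psiL2 n k) = 0 := by
  rw [adjoint_I0_psiL2]
  have h : zernikeFun n (n - 2 * k) = 0 := by
    funext z
    exact zernikeFun_eq_zero _ _ (by rw [lt_abs]; omega) z
  simp only [h]
  rfl

/-! ### Fourier coefficients of U_n(cos θ). -/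

/-- The Fourier coefficients of `θ ↦ U_n(cos θ)`. -/
def chebyshevCoeff (n : ℕ) (m : ℤ) : ℂ :=
  ∫ θ : AddCircle (2 * π), fourier m θ *
    ((Polynomial.Chebyshev.U ℝ n).eval (AddCircle.toCircle θ : ℂ).re : ℝ)

lemma ofReal_re_toCircle (θ : AddCircle (2 * π)) : ((AddCircle.toCircle θ : ℂ).re : ℂ) =
    1 / 2 * fourier (-1) θ + 1 / 2 * fourier 1 θ := by
  rw [Complex.re_eq_add_conj, fourier_neg_one_eq, fourier_one]
  ring

lemma chebyshevCoeff_eq_zero (n : ℕ) (m : ℤ) (h : (n : ℤ) < |m|) : chebyshevCoeff n m = 0 := by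
  simp only [chebyshevCoeff, Polynomial.Chebyshev.complex_ofReal_eval_U, ofReal_re_toCircle]
  exact integral_fourier_mul_eval _ _ _ _ (by rwa [Polynomial.Chebyshev.natDegree_U_natCast])

lemma toCircle_coe_eq_exp (y : ℝ) :
    (AddCircle.toCircle (y : AddCircle (2 * π)) : ℂ) = Complex.exp (y * Complex.I) := by
  rw [← fourier_one, fourier_two_pi]
  congr 1; push_cast; ring

lemma toCircle_coe_re (y : ℝ) :
    (AddCircle.toCircle (y : AddCircle (2 * π)) : ℂ).re = Real.cos y := by
  rw [toCircle_coe_eq_exp, Complex.exp_ofReal_mul_I_re]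

lemma two_mul_chebyshev_T_re (n : ℕ) (θ : AddCircle (2 * π)) :
    2 * (((Polynomial.Chebyshev.T ℝ n).eval (AddCircle.toCircle θ : ℂ).re : ℝ) : ℂ) =
      fourier n θ + fourier (-n) θ := by
  induction θ using QuotientAddGroup.induction_on with
  | H y =>
    rw [toCircle_coe_re, Polynomial.Chebyshev.T_real_cos, fourier_two_pi, fourier_two_pi,
      Complex.ofReal_cos, Complex.cos]
    push_cast
    ring_nf

/-- From U_{n+2} = 2T_{n+2} + U_n and 2T_{n+2}(cos θ) = e^{i(n+2)θ} + e^{-i(n+2)θ}. -/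
lemma chebyshevCoeff_add_two (n : ℕ) (m : ℤ) : chebyshevCoeff (n + 2) m =
    (∫ θ : AddCircle (2 * π), fourier (m + (n + 2 : ℕ)) θ) +
      (∫ θ : AddCircle (2 * π), fourier (m + -(n + 2 : ℕ)) θ) + chebyshevCoeff n m := by
  have e : ∀ θ : AddCircle (2 * π), (fourier m θ *
      ((Polynomial.Chebyshev.U ℝ (n + 2 : ℕ)).eval (AddCircle.toCircle θ : ℂ).re : ℝ) : ℂ) =
      fourier (m + (n + 2 : ℕ)) θ + fourier (m + -(n + 2 : ℕ)) θ + fourier m θ *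
        ((Polynomial.Chebyshev.U ℝ n).eval (AddCircle.toCircle θ : ℂ).re : ℝ) := by
    intro θ
    have h := two_mul_chebyshev_T_re (n + 2) θ
    have h2 : ((n + 2 : ℕ) : ℤ) = (n : ℤ) + 2 := by push_cast; ring
    rw [fourier_add, fourier_add, ← mul_add, ← h, h2, Polynomial.Chebyshev.U_eq_two_mul_T_add_U]
    simp only [Polynomial.eval_add, Polynomial.eval_mul, Polynomial.eval_ofNat]
    push_cast
    ring
  have hc : Continuous fun θ : AddCircle (2 * π) => (fourier m θ *
      ((Polynomial.Chebyshev.U ℝ n).eval (AddCircle.toCircle θ : ℂ).re : ℝ) : ℂ) :=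
    (fourier m).continuous.mul (Complex.continuous_ofReal.comp
      ((Polynomial.Chebyshev.U ℝ n).continuous.comp (Complex.continuous_re.comp continuous_toCircle)))
  unfold chebyshevCoeff
  simp only [e]
  have hf : ∀ j : ℤ, Integrable fun θ : AddCircle (2 * π) => (fourier j θ : ℂ) := fun j =>
    integrable_circle_of_continuous (fourier j).continuous
  rw [integral_add (f := fun θ : AddCircle (2 * π) =>
      (fourier (m + (n + 2 : ℕ)) θ + fourier (m + -(n + 2 : ℕ)) θ : ℂ))
    ((hf _).add (hf _)) (integrable_circle_of_continuous hc),
    integral_add (hf _) (hf _)]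

/-- U_n(cos θ) is a sum of distinct characters, each with coefficient 1, so every integral is 0 or
2π. The bound is uniform in n, whereas the sup norm of U_n grows like n+1. -/
lemma norm_chebyshevCoeff_le (n : ℕ) (m : ℤ) : ‖chebyshevCoeff n m‖ ≤ 2 * π := by
  have hpi : ‖(2 * π : ℂ)‖ = 2 * π := by simp [abs_of_pos Real.pi_pos]
  induction n using Nat.twoStepInduction with
  | zero =>
    simp only [chebyshevCoeff, Nat.cast_zero, Polynomial.Chebyshev.U_zero, Polynomial.eval_one,
      Complex.ofReal_one, mul_one, integral_fourier]
    split_ifs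
    · exact hpi.le
    · rw [norm_zero]; positivity
  | one =>
    by_cases hm : |m| ≤ 1
    · have e : ∀ θ : AddCircle (2 * π), (fourier m θ *
          ((Polynomial.Chebyshev.U ℝ (1 : ℕ)).eval (AddCircle.toCircle θ : ℂ).re : ℝ) : ℂ) =
          fourier (m + -1) θ + fourier (m + 1) θ := by
        intro θ
        have h2 : (2 : Polynomial ℝ).eval (AddCircle.toCircle θ : ℂ).re = 2 := Polynomial.eval_ofNat 2 _
        rw [fourier_add, fourier_add, Nat.cast_one, Polynomial.Chebyshev.U_one, Polynomial.eval_mul,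
          Polynomial.eval_X, h2]
        push_cast
        rw [ofReal_re_toCircle]
        ring
      have hf : ∀ j : ℤ, Integrable fun θ : AddCircle (2 * π) => (fourier j θ : ℂ) := fun j =>
        integrable_circle_of_continuous (fourier j).continuous
      unfold chebyshevCoeff
      simp only [e]
      rw [integral_add (hf _) (hf _), integral_fourier, integral_fourier]
      split_ifs
      · omega
      · rw [add_zero]; exact hpi.le
      · rw [zero_add]; exact hpi.le
      · rw [add_zero, norm_zero]; positivity
    · rw [chebyshevCoeff_eq_zero _ _ (by push_cast; omega), norm_zero]; positivity
  | more n ih _ =>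
    rw [chebyshevCoeff_add_two, integral_fourier, integral_fourier]
    -- The new frequencies ±(n+2) are distinct and absent from U_n, so contributions never
    -- accumulate.
    split_ifs
    · omega
    · rw [chebyshevCoeff_eq_zero _ _ (by rw [lt_abs]; omega), add_zero, add_zero]; exact hpi.le
    · rw [chebyshevCoeff_eq_zero _ _ (by rw [lt_abs]; omega), add_zero, zero_add]; exact hpi.le
    · rw [add_zero, zero_add]; exact ih

/-! ### Chord integrals and the norm of I₀^*ψ_{n,k}. -/

/-- Since T_{n+1}' = (n+1)U_n, the integral is a difference of T_{n+1} at the chord's endpoints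
cos(x-y) and cos(x+y), that is cos((n+1)(x-y)) - cos((n+1)(x+y)), which is a product of sines. -/
lemma integral_chebyshev_chord (n : ℕ) (x y : ℝ) :
    ((n : ℝ) + 1) * ∫ τ in (-Real.sin x)..(Real.sin x),
      (Polynomial.Chebyshev.U ℝ n).eval (Real.cos x * Real.cos y + τ * Real.sin y) =
    2 * Real.sin x * (Polynomial.Chebyshev.U ℝ n).eval (Real.cos x) *
      (Polynomial.Chebyshev.U ℝ n).eval (Real.cos y) := by
  -- The antiderivative requires division by sin y. When sin y = 0 the integrand is constant, with
  -- cos y = ±1, and parity of U_n settles the sign.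
  by_cases hy : Real.sin y = 0
  · simp only [hy, mul_zero, add_zero, intervalIntegral.integral_const, smul_eq_mul]
    rcases Real.sin_eq_zero_iff_cos_eq.1 hy with h | h
    · rw [h, Polynomial.Chebyshev.U_eval_one]
      push_cast
      rw [mul_one]; ring
    · rw [h, Polynomial.Chebyshev.U_eval_neg_one, mul_neg_one, Polynomial.Chebyshev.U_eval_neg]
      push_cast; ring
  · refine mul_right_cancel₀ hy ?_
    have hd : ∀ τ : ℝ, HasDerivAt (fun τ : ℝ => (Polynomial.Chebyshev.T ℝ (n + 1)).eval
        (Real.cos x * Real.cos y + τ * Real.sin y)) (((n : ℝ) + 1) *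
        (Polynomial.Chebyshev.U ℝ n).eval (Real.cos x * Real.cos y + τ * Real.sin y) * Real.sin y) τ := by
      intro τ
      have h1 := (Polynomial.Chebyshev.T ℝ (n + 1)).hasDerivAt
        (Real.cos x * Real.cos y + τ * Real.sin y)
      rw [Polynomial.Chebyshev.T_derivative_eq_U, add_sub_cancel_right] at h1
      have h2 : HasDerivAt (fun τ : ℝ => Real.cos x * Real.cos y + τ * Real.sin y) (Real.sin y) τ := by
        simpa using ((hasDerivAt_id τ).mul_const (Real.sin y)).const_add (Real.cos x * Real.cos y)
      have h3 := h1.comp τ h2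
      refine HasDerivAt.congr_deriv (f' := _) h3 ?_
      simp
    have hI := intervalIntegral.integral_eq_sub_of_hasDerivAt (a := -Real.sin x) (b := Real.sin x)
      (fun τ _ => hd τ) (by
        refine Continuous.intervalIntegrable ?_ _ _
        refine (continuous_const.mul ?_).mul continuous_const
        exact (Polynomial.Chebyshev.U ℝ n).continuous.comp (by fun_prop))
    rw [intervalIntegral.integral_mul_const, intervalIntegral.integral_const_mul] at hI
    rw [hI]
    have c1 : Real.cos x * Real.cos y + Real.sin x * Real.sin y = Real.cos (x - y) :=
      (Real.cos_sub x y).symm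
    have c2 : Real.cos x * Real.cos y + -Real.sin x * Real.sin y = Real.cos (x + y) := by
      rw [Real.cos_add]; ring
    have hx := Polynomial.Chebyshev.U_real_cos x n
    have hyy := Polynomial.Chebyshev.U_real_cos y n
    rw [c1, c2, Polynomial.Chebyshev.T_real_cos, Polynomial.Chebyshev.T_real_cos]
    push_cast at hx hyy ⊢
    have c3 : Real.cos (((n : ℝ) + 1) * (x - y)) - Real.cos (((n : ℝ) + 1) * (x + y)) =
        2 * Real.sin (((n : ℝ) + 1) * x) * Real.sin (((n : ℝ) + 1) * y) := by
      rw [mul_sub, mul_add, Real.cos_sub, Real.cos_add]; ring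
    rw [c3, ← hx, ← hyy]
    ring

lemma integral_ridge_geodesic (n : ℕ) (θ : AddCircle (2 * π)) (p : Fan) :
    ((n : ℝ) + 1) * ∫ t in (0 : ℝ)..exitTime p, ridge n θ (geodesic p t) =
      2 * (Real.cos p.2 * (Polynomial.Chebyshev.U ℝ n).eval (-Real.sin p.2)) *
      (Polynomial.Chebyshev.U ℝ n).eval
        (AddCircle.toCircle (p.1 + (p.2 : AddCircle (2 * π)) - θ) : ℂ).re := by
  obtain ⟨y, hy⟩ : ∃ y : ℝ, (y : AddCircle (2 * π)) = p.1 + (p.2 : AddCircle (2 * π)) - θ :=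
    QuotientAddGroup.mk_surjective _
  -- Chord coordinates: x = α + π/2, y the angle between the line and the ridge, and τ = sin x - t
  -- measured from the midpoint of the chord.
  have hr : ∀ t : ℝ, ridge n θ (geodesic p t) = (Polynomial.Chebyshev.U ℝ n).eval
      (Real.cos (p.2 + π / 2) * Real.cos y + (Real.sin (p.2 + π / 2) - t) * Real.sin y) := by
    intro t
    have h1 : (starRingEnd ℂ) (AddCircle.toCircle θ : ℂ) *
        AddCircle.toCircle (p.1 + (p.2 : AddCircle (2 * π))) = Complex.exp (y * Complex.I) := by
      have : p.1 + (p.2 : AddCircle (2 * π)) = θ + y := by rw [hy]; abel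
      rw [this, AddCircle.toCircle_add, Circle.coe_mul, ← mul_assoc, toCircle_mul_conj, one_mul,
        toCircle_coe_eq_exp]
    rw [ridge, geodesic_eq, ← mul_assoc, h1, Real.cos_add_pi_div_two, Real.sin_add_pi_div_two]
    congr 1
    rw [Complex.exp_mul_I, ← Complex.ofReal_cos, ← Complex.ofReal_sin]
    simp [-Complex.ofReal_cos, -Complex.ofReal_sin]
    ring
  have he : exitTime p = 2 * Real.sin (p.2 + π / 2) := by
    rw [Real.sin_add_pi_div_two, exitTime]
  have hi := integral_chebyshev_chord n (p.2 + π / 2) y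
  rw [← hy, toCircle_coe_re]
  simp only [hr, he]
  rw [intervalIntegral.integral_comp_sub_left (fun τ => (Polynomial.Chebyshev.U ℝ n).eval
    (Real.cos (p.2 + π / 2) * Real.cos y + τ * Real.sin y)), sub_zero,
    show Real.sin (p.2 + π / 2) - 2 * Real.sin (p.2 + π / 2) = -Real.sin (p.2 + π / 2) by ring, hi,
    Real.cos_add_pi_div_two, Real.sin_add_pi_div_two]
  ring

lemma continuous_geodesic (p : Fan) : Continuous (geodesic p) := by
  unfold geodesic; fun_prop

/-- By Fubini the transform acts on each ridge separately. The chord formula leaves a function of α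
times U_n(cos(φ-θ)), and integration against e^{imθ} is then a convolution, which has e^{imφ} as an
eigenfunction. -/
lemma xray_zernikeFun (n : ℕ) (k : ℤ) {p : Fan} (hp : 0 < Real.cos p.2) :
    xray (zernikeFun n (n - 2 * k)) p =
      2 / ((n : ℂ) + 1) * chebyshevCoeff n (-(n - 2 * k)) * psi n k p := by
  have h0 : 0 ≤ exitTime p := by unfold exitTime; positivity
  have hn : (n : ℂ) + 1 ≠ 0 := by exact_mod_cast Nat.succ_ne_zero n
  set m : ℤ := n - 2 * k with hm
  set φ : AddCircle (2 * π) := p.1 + (p.2 : AddCircle (2 * π)) with hφ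
  have hint : Integrable (fun q : ℝ × AddCircle (2 * π) =>
      (fourier m q.2 * ridge n q.2 (geodesic p q.1) : ℂ))
      ((volume.restrict (Icc 0 (exitTime p))).prod volume) := by
    have hc : Continuous (fun q : ℝ × AddCircle (2 * π) =>
      (fourier m q.2 * ridge n q.2 (geodesic p q.1) : ℂ)) :=
      (continuous_zernikeKernel n m).comp
        (continuous_snd.prodMk ((continuous_geodesic p).comp continuous_fst))
    have h2 := hc.continuousOn.integrableOn_compact (μ := volume.prod volume)
      ((isCompact_Icc (a := (0 : ℝ)) (b := exitTime p)).prod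
        (isCompact_univ (X := AddCircle (2 * π))))
    rw [IntegrableOn, ← Measure.prod_restrict, Measure.restrict_univ] at h2
    exact h2
  have hswap : xray (zernikeFun n m) p = psiConst n * ∫ θ : AddCircle (2 * π), fourier m θ *
      ((∫ t in (0 : ℝ)..exitTime p, ridge n θ (geodesic p t) : ℝ) : ℂ) := by
    simp only [xray, zernikeFun]
    rw [intervalIntegral.integral_const_mul, intervalIntegral.integral_of_le h0,
      ← integral_Icc_eq_integral_Ioc, integral_integral_swap hint]
    congr 1
    refine integral_congr_ae (Filter.Eventually.of_forall fun θ => ?_)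
    simp only
    rw [integral_const_mul, intervalIntegral.integral_of_le h0, ← integral_Icc_eq_integral_Ioc,
      integral_complex_ofReal]
  have hA : ∫ θ : AddCircle (2 * π), fourier m θ * ((Polynomial.Chebyshev.U ℝ n).eval
      (AddCircle.toCircle (φ - θ) : ℂ).re : ℝ) = fourier m φ * chebyshevCoeff n (-m) := by
    rw [← integral_sub_left_eq_self _ volume φ, chebyshevCoeff, ← integral_const_mul]
    refine integral_congr_ae (Filter.Eventually.of_forall fun θ => ?_)
    simp only [sub_sub_cancel]
    have : (fourier m (φ - θ) : ℂ) = fourier m φ * fourier (-m) θ := by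
      simp only [fourier_apply, sub_eq_add_neg, smul_add, AddCircle.toCircle_add, Circle.coe_mul,
        smul_neg, neg_smul]
    rw [this]
    ring
  have hr : ∀ θ : AddCircle (2 * π), fourier m θ *
      ((∫ t in (0 : ℝ)..exitTime p, ridge n θ (geodesic p t) : ℝ) : ℂ) =
      (2 / ((n : ℂ) + 1) *
        (Real.cos p.2 * (Polynomial.Chebyshev.U ℝ n).eval (-Real.sin p.2) : ℝ)) *
      (fourier m θ * ((Polynomial.Chebyshev.U ℝ n).eval (AddCircle.toCircle (φ - θ) : ℂ).re : ℝ)) := by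
    intro θ
    have h := congrArg (fun x : ℝ => (x : ℂ)) (integral_ridge_geodesic n θ p)
    simp only [Complex.ofReal_mul, Complex.ofReal_add, Complex.ofReal_natCast, Complex.ofReal_one] at h
    refine mul_left_cancel₀ hn ?_
    rw [mul_left_comm, h]
    push_cast
    field_simp
    rw [hφ]
  rw [hswap]
  simp only [hr]
  rw [integral_const_mul, hA, psi_eq_chebyshev]
  ring

/-- With Z = I₀^*ψ one has ‖Z‖² = ⟨ψ, I₀Z⟩, and I₀Z is an explicit multiple of ψ with ‖ψ‖² = 1/4. -/
lemma norm_sq_adjoint_I0_psiL2_le (n : ℕ) (k : ℤ) :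
    ‖ContinuousLinearMap.adjoint I0 (psiL2 n k)‖ ^ 2 ≤ π / (n + 1) := by
  set Z := ContinuousLinearMap.adjoint I0 (psiL2 n k) with hZ
  have hIZ : I0 Z = (2 / ((n : ℂ) + 1) * chebyshevCoeff n (-(n - 2 * k))) • psiL2 n k := by
    apply Lp.ext
    have hZf : Z =ᵐ[diskMeasure] zernikeFun n (n - 2 * k) := by
      rw [hZ, adjoint_I0_psiL2]; exact MemLp.coeFn_toLp _
    filter_upwards [coeFn_I0 Z, xray_congr hZf, ae_cos_pos, (memLp_psi n k).coeFn_toLp,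
      Lp.coeFn_smul (2 / ((n : ℂ) + 1) * chebyshevCoeff n (-(n - 2 * k))) (psiL2 n k)]
      with p h1 h2 h3 h4 h5
    rw [h1, h2, xray_zernikeFun n k h3, h5, Pi.smul_apply, psiL2, h4, smul_eq_mul]
  have h : inner ℂ Z Z = inner ℂ (psiL2 n k) (I0 Z) := ContinuousLinearMap.adjoint_inner_left _ _ _
  rw [hIZ, inner_smul_right, inner_psiL2, if_pos ⟨rfl, rfl⟩] at h
  have h2 : ‖Z‖ ^ 2 = ‖2 / ((n : ℂ) + 1) * chebyshevCoeff n (-(n - 2 * k)) * (1 / 4)‖ := by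
    rw [← h, inner_self_eq_norm_sq_to_K]; simp
  have hn : ‖(n : ℂ) + 1‖ = n + 1 := by
    rw [← Nat.cast_one, ← Nat.cast_add, Complex.norm_natCast]; push_cast; ring
  rw [h2, norm_mul, norm_mul, norm_div, hn, norm_div]
  simp only [Complex.norm_ofNat, norm_one]
  calc 2 / ((n : ℝ) + 1) * ‖chebyshevCoeff n (-(n - 2 * k))‖ * (1 / 4) ≤
      2 / ((n : ℝ) + 1) * (2 * π) * (1 / 4) := by
        gcongr; exact norm_chebyshevCoeff_le _ _
    _ = π / (n + 1) := by ring

/-! ### Symmetry and vanishing coefficients of X-ray data. -/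

lemma geodesic_scatter (p : Fan) (t : ℝ) :
    geodesic (scatter p) t = geodesic p (exitTime p - t) := by
  have e : (scatter p).1 + ((scatter p).2 : AddCircle (2 * π)) =
      p.1 + (p.2 : AddCircle (2 * π)) + ((π : ℝ) : AddCircle (2 * π)) := by
    simp only [scatter]
    rw [add_assoc, add_assoc, ← AddCircle.coe_add, ← AddCircle.coe_add]
    congr 2; ring
  rw [geodesic_eq, geodesic_eq, e, ← fourier_one, ← fourier_one, fourier_add_pi]
  simp only [scatter, exitTime, Real.cos_neg, Real.sin_neg, zpow_one]
  push_cast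
  ring

lemma xray_scatter (f : ℂ → ℂ) (p : Fan) : xray f (scatter p) = xray f p := by
  have he : exitTime (scatter p) = exitTime p := by simp [exitTime, scatter]
  unfold xray
  simp only [geodesic_scatter, he]
  rw [intervalIntegral.integral_comp_sub_left (fun t => f (geodesic p t)), sub_self, sub_zero]

lemma I0_mem_L2plus (f : L2Disk) : I0 f ∈ L2plus :=
  toLp_mem_L2plus (memLp_xray f) (xray_scatter f)

lemma inner_psiHat_I0_eq_zero (n : ℕ) (k : ℤ) (hk : k < 0 ∨ (n : ℤ) < k) (f : L2Disk) :
    inner ℂ (psiHat n k) (I0 f) = 0 := by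
  rw [psiHat_eq, inner_smul_left, ← ContinuousLinearMap.adjoint_inner_left,
    adjoint_I0_psiL2_eq_zero n k hk, inner_zero_left, mul_zero]

/-- Orthogonality to a fixed vector is a closed condition, so it passes from the range to its
closure. -/
lemma inner_psiHat_eq_zero_of_mem_closure (n : ℕ) (k : ℤ) (hk : k < 0 ∨ (n : ℤ) < k) {w : L2Fan}
    (hw : w ∈ (LinearMap.range (I0 : L2Disk →ₗ[ℂ] L2Fan)).topologicalClosure) :
    inner ℂ (psiHat n k) w = 0 := by
  have hle : (LinearMap.range (I0 : L2Disk →ₗ[ℂ] L2Fan)).topologicalClosure ≤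
      LinearMap.ker (innerSL ℂ (psiHat n k) : L2Fan →ₗ[ℂ] ℂ) := by
    refine Submodule.topologicalClosure_minimal _ ?_ (innerSL ℂ (psiHat n k)).isClosed_ker
    rintro _ ⟨f, rfl⟩
    exact inner_psiHat_I0_eq_zero n k hk f
  exact hle hw

/-! ### Comparison of the two Sobolev scales. -/

lemma DiagonalOperator.sobolev_of_normTerm_le {P : DiagonalOperator}
    (hP : ∀ n k, 0 ≤ P.eigenvalue n k) {s : ℝ} {u : L2Fan} (hu : u ∈ L2plus) {g : ℕ × ℤ → ℝ}
    (hg : Summable g) (hle : ∀ nk, P.normTerm s u nk ≤ g nk) :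
    u ∈ P.sobolev s ∧ P.sobolevNorm s u ≤ √(∑' nk, g nk) := by
  have hs : Summable (P.normTerm s u) := Summable.of_nonneg_of_le (normTerm_nonneg hP s u) hle hg
  have hm := (mem_sobolev_iff hP).2 ⟨hu, hs⟩
  refine ⟨hm, Real.le_sqrt_of_sq_le ?_⟩
  rw [sobolevNorm_sq hP hm]
  exact hs.tsum_le_tsum hle hg

lemma negTSq_normTerm_le {s : ℝ} (hs : 0 ≤ s) (u : L2Fan) (nk : ℕ × ℤ) :
    negTSq.normTerm s u nk ≤ negEllip.normTerm s u nk := by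
  refine mul_le_mul_of_nonneg_right (Real.rpow_le_rpow (negTSq_eigenvalue_nonneg _ _) ?_ hs)
    (sq_nonneg _)
  simp only [negTSq, negEllip]
  nlinarith [sq_nonneg ((nk.1 : ℝ) - 2 * nk.2)]

lemma negEllip_normTerm_le {s : ℝ} (hs : 0 ≤ s) {u : L2Fan}
    (hu : ∀ (n : ℕ) (k : ℤ), k < 0 ∨ (n : ℤ) < k → inner ℂ (psiHat n k) u = 0) (nk : ℕ × ℤ) :
    negEllip.normTerm s u nk ≤ 2 ^ s * negTSq.normTerm s u nk := by
  obtain ⟨n, k⟩ := nk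
  by_cases hk : k < 0 ∨ (n : ℤ) < k
  · simp [DiagonalOperator.normTerm, hu n k hk]
  · push Not at hk
    have h1 : (0 : ℝ) ≤ k := by exact_mod_cast hk.1
    have h2 : (k : ℝ) ≤ n := by exact_mod_cast hk.2
    unfold DiagonalOperator.normTerm
    rw [← mul_assoc, ← Real.mul_rpow (by norm_num) (negTSq_eigenvalue_nonneg _ _)]
    refine mul_le_mul_of_nonneg_right (Real.rpow_le_rpow (negEllip_eigenvalue_nonneg _ _) ?_ hs)
      (sq_nonneg _)
    simp only [negTSq, negEllip]
    -- For 0 ≤ k ≤ n, (n-2k)² ≤ n² ≤ (n+1)²; this is the origin of the factor 2.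
    nlinarith

lemma HPlus_le_HT {s : ℝ} (hs : 0 ≤ s) : HPlus s ≤ HT s := by
  intro u hu
  obtain ⟨hu1, hu2⟩ := (DiagonalOperator.mem_sobolev_iff negEllip_eigenvalue_nonneg).1 hu
  exact (DiagonalOperator.sobolev_of_normTerm_le negTSq_eigenvalue_nonneg hu1 hu2
    (negTSq_normTerm_le hs u)).1

lemma normHT_le_normHPlus {s : ℝ} (hs : 0 ≤ s) {u : L2Fan} (hu : u ∈ HPlus s) :
    normHT s u ≤ normHPlus s u := by
  obtain ⟨hu1, hu2⟩ := (DiagonalOperator.mem_sobolev_iff negEllip_eigenvalue_nonneg).1 hu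
  refine (DiagonalOperator.sobolev_of_normTerm_le negTSq_eigenvalue_nonneg hu1 hu2
    (negTSq_normTerm_le hs u)).2.trans ?_
  rw [← DiagonalOperator.sobolevNorm_sq negEllip_eigenvalue_nonneg hu]
  exact (Real.sqrt_sq (norm_nonneg _)).le

lemma HPlus_of_HT {s : ℝ} (hs : 0 ≤ s) {u : L2Fan}
    (hu : ∀ (n : ℕ) (k : ℤ), k < 0 ∨ (n : ℤ) < k → inner ℂ (psiHat n k) u = 0) (hT : u ∈ HT s) :
    u ∈ HPlus s ∧ normHPlus s u ≤ √(2 ^ s) * normHT s u := by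
  obtain ⟨hu1, hu2⟩ := (DiagonalOperator.mem_sobolev_iff negTSq_eigenvalue_nonneg).1 hT
  have h := DiagonalOperator.sobolev_of_normTerm_le negEllip_eigenvalue_nonneg hu1
    (hu2.mul_left (2 ^ s)) (negEllip_normTerm_le hs hu)
  refine ⟨h.1, h.2.trans ?_⟩
  rw [tsum_mul_left, ← DiagonalOperator.sobolevNorm_sq negTSq_eigenvalue_nonneg hT,
    Real.sqrt_mul (by positivity),
    Real.sqrt_sq (show 0 ≤ negTSq.sobolevNorm s u from norm_nonneg _)]
  exact le_rfl

/-- On the row n = 0 the operator -T² is the identity, so the T-norm sees no decay in k, while the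
elliptic eigenvalue is 1+4k². Any square-summable row with too slow a decay separates the spaces. -/
lemma HPlus_ne_HT {s : ℝ} (hs : 0 < s) : HPlus s ≠ HT s := by
  let e : ℕ → ℕ × ℤ := fun j => (0, (j : ℤ))
  have he : Function.Injective e := fun i j h => by simpa [e] using h
  -- The squares (j+1)^(-1-s) are summable because s > 0, yet multiplied by (1+4j²)^s ≥ (j+1)^s they
  -- dominate the harmonic series.
  let a : ℕ → ℂ := fun j => ((((j : ℝ) + 1) ^ (-(1 + s) / 2) : ℝ) : ℂ)
  let c : ℕ × ℤ → ℂ := Function.extend e a 0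
  have hce : ∀ j, c (e j) = a j := fun j => he.extend_apply a 0 j
  have hc0 : ∀ nk, nk ∉ range e → c nk = 0 := fun nk h => by
    simp only [c]
    rw [Function.extend_apply' _ _ _ (by simpa using h)]
    rfl
  have ha : ∀ j, ‖a j‖ ^ 2 = ((j : ℝ) + 1) ^ (-(1 + s)) := by
    intro j
    have hj : (0 : ℝ) ≤ (j : ℝ) + 1 := by positivity
    simp only [a]
    rw [Complex.norm_real, Real.norm_eq_abs, sq_abs, ← Real.rpow_natCast, ← Real.rpow_mul hj]
    congr 1; push_cast; ring
  have hsum : Summable fun nk => ‖c nk‖ ^ 2 := by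
    rw [← he.summable_iff (fun nk h => by rw [hc0 nk h]; simp)]
    simp only [Function.comp_def, hce, ha]
    have h := (summable_nat_add_iff 1).2 (Real.summable_nat_rpow.2 (show -(1 + s) < -1 by linarith))
    simpa using h
  have hS := (summable_smul_iff_of_orthonormal orthonormal_psiHat c).2 hsum
  set u := ∑' nk, c nk • psiHat nk.1 nk.2 with hu
  have hin : ∀ nk : ℕ × ℤ, inner ℂ (psiHat nk.1 nk.2) u = c nk :=
    inner_tsum_smul_of_orthonormal orthonormal_psiHat hS
  have huT : u ∈ HT s := by
    refine (DiagonalOperator.mem_sobolev_iff negTSq_eigenvalue_nonneg).2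
      ⟨tsum_psiHat_mem_L2plus c, hsum.congr fun nk => ?_⟩
    rw [DiagonalOperator.normTerm, hin]
    by_cases hnk : nk ∈ range e
    · obtain ⟨j, rfl⟩ := hnk
      simp [negTSq, e]
    · rw [hc0 nk hnk]; simp
  intro heq
  rw [← heq] at huT
  have h := ((DiagonalOperator.mem_sobolev_iff negEllip_eigenvalue_nonneg).1 huT).2.comp_injective he
  have hdiv : ¬ Summable fun j : ℕ => ((j : ℝ) + 1) ^ (-1 : ℝ) := by
    have h1 := (summable_nat_add_iff (f := fun j : ℕ => (j : ℝ) ^ (-1 : ℝ)) 1).not.2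
      (by rw [Real.summable_nat_rpow]; norm_num)
    simpa using h1
  refine hdiv (Summable.of_nonneg_of_le (fun j => by positivity) (fun j => ?_) h)
  have hj : (0 : ℝ) < (j : ℝ) + 1 := by positivity
  have hjj : (j : ℝ) ≤ (j : ℝ) ^ 2 := by exact_mod_cast Nat.le_self_pow two_ne_zero j
  simp only [Function.comp_apply, DiagonalOperator.normTerm, hin, hce, ha]
  calc ((j : ℝ) + 1) ^ (-1 : ℝ) = ((j : ℝ) + 1) ^ s * ((j : ℝ) + 1) ^ (-(1 + s)) := by
        rw [← Real.rpow_add hj]; congr 1; ring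
    _ ≤ _ := by
        refine mul_le_mul_of_nonneg_right (Real.rpow_le_rpow hj.le ?_ hs.le) (by positivity)
        simp only [negEllip, e]
        push_cast
        nlinarith

/-! ### The mapping property of I₀ on the Zernike scale. -/

lemma zernikeTerm_hasSum (s : ℝ) (f : L2Disk) (n : ℕ) :
    HasSum (fun k : ℤ => if 0 ≤ k ∧ k ≤ n then
      ((n : ℝ) + 1) ^ (2 * s) * ‖inner ℂ (zernikeHat n k.toNat) f‖ ^ 2 else 0)
      (zernikeTerm s f n) := by
  have h := hasSum_sum_of_ne_finset_zero (f := fun k : ℤ => if 0 ≤ k ∧ k ≤ n then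
      ((n : ℝ) + 1) ^ (2 * s) * ‖inner ℂ (zernikeHat n k.toNat) f‖ ^ 2 else 0)
    (s := (Finset.range (n + 1)).map Nat.castEmbedding) (L := SummationFilter.unconditional ℤ) (by
      intro k hk
      rw [if_neg]
      rintro ⟨h1, h2⟩
      refine hk (Finset.mem_map.2 ⟨k.toNat, ?_, ?_⟩)
      · rw [Finset.mem_range]; omega
      · simp [h1])
  convert h using 1
  rw [Finset.sum_map, zernikeTerm, Finset.mul_sum]
  refine Finset.sum_congr rfl fun k hk => ?_
  rw [Finset.mem_range] at hk
  rw [if_pos (by simp; omega)]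
  simp

lemma norm_sq_inner_psiHat_I0_le (n k : ℕ) (f : L2Disk) :
    ‖inner ℂ (psiHat n k) (I0 f)‖ ^ 2 ≤
      4 * π / (n + 1) * ‖inner ℂ (zernikeHat n k) f‖ ^ 2 := by
  -- Also valid if the vector is zero, so nonvanishing of Z_{n,k} is never required.
  have hz : zernike n k = ((‖zernike n k‖ : ℝ) : ℂ) • zernikeHat n k := by
    by_cases h : ‖zernike n k‖ = 0
    · rw [norm_eq_zero.1 h]; simp
    · rw [zernikeHat, smul_smul, ← Complex.ofReal_mul, mul_inv_cancel₀ h, Complex.ofReal_one, one_smul]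
  have h1 : inner ℂ (psiHat n k) (I0 f) = 2 * (‖zernike n k‖ * inner ℂ (zernikeHat n k) f) := by
    rw [psiHat_eq, inner_smul_left, ← ContinuousLinearMap.adjoint_inner_left, ← zernike,
      map_ofNat]
    conv_lhs => rw [hz, inner_smul_left, Complex.conj_ofReal]
  rw [h1, norm_mul, norm_mul, mul_pow, mul_pow, Complex.norm_ofNat, Complex.norm_real, norm_norm,
    ← mul_assoc]
  refine mul_le_mul_of_nonneg_right ?_ (sq_nonneg _)
  have h2 := norm_sq_adjoint_I0_psiL2_le n k
  rw [← zernike] at h2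
  calc (2 : ℝ) ^ 2 * ‖zernike n k‖ ^ 2 ≤ 2 ^ 2 * (π / (n + 1)) := by gcongr
    _ = 4 * π / (n + 1) := by ring

/-- The weight (n+1)^(2s+1) at order s+1/2 exceeds the Zernike weight by one power of n+1, exactly
cancelled by the factor 4π/(n+1) in `norm_sq_inner_psiHat_I0_le`. -/
lemma I0_mem_HT {s : ℝ} {f : L2Disk} (hf : f ∈ HTilde s) :
    I0 f ∈ HT (s + 1 / 2) ∧ normHT (s + 1 / 2) (I0 f) ≤ √(4 * π) * normHTilde s f := by
  set g : ℕ × ℤ → ℝ := fun nk => if 0 ≤ nk.2 ∧ nk.2 ≤ nk.1 then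
      ((nk.1 : ℝ) + 1) ^ (2 * s) * ‖inner ℂ (zernikeHat nk.1 nk.2.toNat) f‖ ^ 2 else 0 with hg
  have hg0 : 0 ≤ g := fun nk => by
    simp only [hg, Pi.zero_apply]; split_ifs <;> positivity
  have hsum : ∀ n, HasSum (fun k => g (n, k)) (zernikeTerm s f n) := zernikeTerm_hasSum s f
  have hgs : Summable g := by
    rw [summable_prod_of_nonneg hg0]
    refine ⟨fun n => (hsum n).summable, ?_⟩
    simp only [(hsum _).tsum_eq]
    exact hf
  have hgt : ∑' nk, g nk = ∑' n, zernikeTerm s f n := by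
    rw [hgs.tsum_prod]
    simp only [(hsum _).tsum_eq]
  have hle : ∀ nk, negTSq.normTerm (s + 1 / 2) (I0 f) nk ≤ 4 * π * g nk := by
    rintro ⟨n, k⟩
    by_cases hk : 0 ≤ k ∧ k ≤ n
    · have hn : (0 : ℝ) < (n : ℝ) + 1 := by positivity
      obtain ⟨j, rfl⟩ := Int.eq_ofNat_of_zero_le hk.1
      simp only [hg, if_pos hk, DiagonalOperator.normTerm, negTSq, Int.toNat_natCast]
      have e : (((n : ℝ) + 1) ^ 2) ^ (s + 1 / 2) = ((n : ℝ) + 1) ^ (2 * s) * (n + 1) := by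
        rw [← Real.rpow_natCast, ← Real.rpow_mul hn.le, ← Real.rpow_add_one hn.ne']
        congr 1; push_cast; ring
      rw [e]
      calc ((n : ℝ) + 1) ^ (2 * s) * (n + 1) * ‖inner ℂ (psiHat n j) (I0 f)‖ ^ 2 ≤
          ((n : ℝ) + 1) ^ (2 * s) * (n + 1) *
            (4 * π / (n + 1) * ‖inner ℂ (zernikeHat n j) f‖ ^ 2) := by
            gcongr; exact norm_sq_inner_psiHat_I0_le n j f
        _ = 4 * π * (((n : ℝ) + 1) ^ (2 * s) * ‖inner ℂ (zernikeHat n j) f‖ ^ 2) := by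
            field_simp
    -- Outside 0 ≤ k ≤ n there is no Zernike coefficient to compare with; the data coefficient
    -- vanishes there.
    · have h0 : inner ℂ (psiHat n k) (I0 f) = 0 := inner_psiHat_I0_eq_zero n k (by omega) f
      simp only [hg, if_neg hk, DiagonalOperator.normTerm, h0]
      simp
  have h := DiagonalOperator.sobolev_of_normTerm_le negTSq_eigenvalue_nonneg (I0_mem_L2plus f)
    (hgs.mul_left (4 * π)) hle
  refine ⟨h.1, h.2.trans ?_⟩
  rw [tsum_mul_left, hgt, Real.sqrt_mul (by positivity)]
  exact le_rfl

end
end XrayDisk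

theorem proposition3p7 (s : ℝ) (hs : 0 ≤ s) :
    (HPlus s ≤ HT s ∧ (0 < s → HPlus s ≠ HT s)) ∧
    ((∀ w ∈ (LinearMap.range (I0 : L2Disk →ₗ[ℂ] L2Fan)).topologicalClosure,
        (w ∈ HPlus s ↔ w ∈ HT s)) ∧
      ∃ c : ℝ, 0 < c ∧ ∃ C : ℝ, 0 < C ∧
        ∀ w ∈ (LinearMap.range (I0 : L2Disk →ₗ[ℂ] L2Fan)).topologicalClosure,
          w ∈ HT s → c * normHT s w ≤ normHPlus s w ∧ normHPlus s w ≤ C * normHT s w) ∧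
    (∃ C : ℝ, 0 < C ∧ ∀ f ∈ HTilde s,
      I0 f ∈ HPlus (s + 1 / 2) ∧ normHPlus (s + 1 / 2) (I0 f) ≤ C * normHTilde s f) := by
  have hz : ∀ w ∈ (LinearMap.range (I0 : L2Disk →ₗ[ℂ] L2Fan)).topologicalClosure,
      ∀ (n : ℕ) (k : ℤ), k < 0 ∨ (n : ℤ) < k → inner ℂ (psiHat n k) w = 0 :=
    fun w hw n k hk => inner_psiHat_eq_zero_of_mem_closure n k hk hw
  refine ⟨⟨HPlus_le_HT hs, HPlus_ne_HT⟩, ⟨fun w hw => ⟨fun h => HPlus_le_HT hs h,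
    fun h => (HPlus_of_HT hs (hz w hw) h).1⟩, 1, one_pos, √(2 ^ s), by positivity,
    fun w hw h => ?_⟩, √(2 ^ (s + 1 / 2)) * √(4 * Real.pi), by positivity, fun f hf => ?_⟩
  · obtain ⟨h1, h2⟩ := HPlus_of_HT hs (hz w hw) h
    exact ⟨by rw [one_mul]; exact normHT_le_normHPlus hs h1, h2⟩
  -- The gain is proved in the T-scale and transferred by the comparison at order s+1/2, available
  -- because the data lies in the range.
  · obtain ⟨h1, h2⟩ := I0_mem_HT hf
    obtain ⟨h3, h4⟩ := HPlus_of_HT (by positivity : 0 ≤ s + 1 / 2)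
      (hz _ (Submodule.le_topologicalClosure _ ⟨f, rfl⟩)) h1
    refine ⟨h3, h4.trans ?_⟩
    rw [mul_assoc]
    exact mul_le_mul_of_nonneg_left h2 (Real.sqrt_nonneg _)
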